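/- **Setting.** The antenna tower is the frame of four Euler–Bernoulli beams $e_0,e_1,e_2,e_3$ meeting at a joint $\mathfrak v_c$: a vertical antenna $e_0$ of length $\ell_0>0$ running from its top $\mathfrak v_0$ ($x=0$) to $\mathfrak v_c$ ($x=\ell_0$), and three legs $e_s$, $s=1,2,3$, of length $\ell>0$ running from their feet $\mathfrak v_s$ ($x=0$) to $\mathfrak v_c$ ($x=\ell$). Their right-handed local bases are $\vec i_0=(0,0,-1)$, $\vec j_0=(0,1,0)$, $\vec k_0=(1,0,0)$, $\vec i_1=(\cos\alpha,0,\sin\alpha)$, $\vec j_1=(0,1,0)$, $\vec k_1=(-\sin\alpha,0,\cos\alpha)$, and $\{\vec i_{s+1},\vec j_{s+1},\vec k_{s+1}\}=\{R\vec i_s,R\vec j_s,R\vec k_s\}$ for $s=1,2$, where $\alpha\in\mathbb R$ and $R$ is the rotation by $2\pi/3$ about the vertical axis, $R=\begin{pmatrix}\cos\frac{2\pi}3&-\sin\frac{2\pi}3&0\\ \sin\frac{2\pi}3&\cos\frac{2\pi}3&0\\0&0&1\end{pmatrix}$. The stiffness constants are positive, equal to $(a,b,c,d)$ on each leg and to $(a_0,b_0,c_0,d_0)$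 with $b_0=a_0$ on the antenna. The state space is $L^2(\Gamma)=\bigoplus_{e}L^2(0,\ell_e)^4$ with complex-valued fields $\Psi_e=(v_e,w_e,u_e,\eta_e)$ (displacement $u_e\vec i_e+w_e\vec j_e+v_e\vec k_e$ and angular displacement $\eta_e$ about the axis). The Hamiltonian $H$ acts as $(v_e,w_e,u_e,\eta_e)\mapsto(a_ev_e'''',\,b_ew_e'''',\,-c_eu_e'',\,-d_e\eta_e'')$ on the domain of all $\Psi$ with $v_e,w_e\in H^4(0,\ell_e)$, $u_e,\eta_e\in H^2(0,\ell_e)$ such that: at every joint, $u_e\vec i_e+w_e\vec j_e+v_e\vec k_e$ and $\eta_e\vec i_e-v_e'\vec j_e+w_e'\vec k_e$ are the same for all beams $e$ at that joint; at the feet both vectors vanish (clamped); and at the free joints $\mathfrak v\in\{\mathfrak v_c,\mathfrak v_0\}$ $$\sum_{e\sim\mathfrak v}s^e_{\mathfrak v}\,(c_eu_e'\vec i_e-b_ew_e'''\vec j_e-a_ev_e'''\vec k_e)=0,\qquad \sum_{e\sim\mathfrak v}s^e_{\mathfrak v}\,(d_e\eta_e'\vec i_e-a_ev_e''\vec j_e+b_ew_e''\vec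 k_e)=0,$$ where $s^e_{\mathfrak v}=1$ if $e$ starts at $\mathfrak v$ and $-1$ if it ends there. The dihedral group $D_3=\langle R,F\mid R^3=F^2=FRFR=1\rangle$, with $R$ as above and $F=\operatorname{diag}(1,-1,1)$, acts on $L^2(\Gamma)$: $R$ fixes $e_0$ and maps $e_1\mapsto e_2\mapsto e_3\mapsto e_1$; $F$ fixes $e_0,e_1$ and swaps $e_2,e_3$; a transformation $T$ mapping $e$ to $e'$ sends the displacement field $\vec g_e$ on $e$ to the field $T\vec g_e$ on $e'$, and $\eta_e$ to $(\det T)\,\eta_e$ on $e'$. Let $\omega=e^{2\pi\mathrm i/3}$ and $$\begin{aligned} \mathcal H_{\mathrm{trv}}&=\{\Psi: v_0=w_0=\eta_0=0,\ w_s=\eta_s=0\ (s=1,2,3),\ v_1=v_2=v_3,\ u_1=u_2=u_3\},\\ \mathcal H_{\mathrm{alt}}&=\{\Psi: v_0=w_0=u_0=0,\ u_s=v_s=0\ (s=1,2,3),\ w_1=w_2=w_3,\ \eta_1=\eta_2=\eta_3\},\\ \mathcal H_{\omega}&=\{\Psi: u_0=\eta_0=0,\ w_0=\mathrm i\,v_0,\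 \Psi_3=\omega\Psi_2=\omega^2\Psi_1\},\\ \mathcal H_{\overline\omega}&=\{\Psi: u_0=\eta_0=0,\ w_0=-\mathrm i\,v_0,\ \Psi_3=\overline\omega\Psi_2=\overline\omega^2\Psi_1\}. \end{aligned}$$ **Theorem.** 1. $L^2(\Gamma)=\mathcal H_{\mathrm{trv}}\oplus\mathcal H_{\mathrm{alt}}\oplus\mathcal H_\omega\oplus\mathcal H_{\overline\omega}$ is an orthogonal decomposition into closed subspaces, and it reduces $H$: each summand is invariant under $H$, $\operatorname{Dom}(H)$ is the sum of its intersections with the summands, and the orthogonal projector onto each summand preserves $\operatorname{Dom}(H)$ and commutes with $H$. 2. The action of each element of $D_3$ preserves $\operatorname{Dom}(H)$ and commutes with $H$. The subspaces $\mathcal H_{\mathrm{trv}}$, $\mathcal H_{\mathrm{alt}}$ and $\mathcal H_\omega\oplus\mathcal H_{\overline\omega}$ are the isotypic components in $L^2(\Gamma)$ of the trivial, the alternating ($R\mapsto1$, $F\mapsto-1$) and the two-dimensional standard representation of $D_3$. The last one is split by the cyclic group $C_3=\langle R\rangle$: $\mathcal H_\omega$ and $\mathcal H_{\overline\omega}$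 are the eigenspaces of the action of $R$ on $L^2(\Gamma)$ with eigenvalues $\overline\omega$ and $\omega$ respectively. 3. $\mathcal H_\omega=\overline{\mathcal H_{\overline\omega}}$ (complex conjugation of all fields). For every $\lambda\in\mathbb C$ the eigenspaces $\ker(H-\lambda)\cap\mathcal H_\omega$ and $\ker(H-\lambda)\cap\mathcal H_{\overline\omega}$ have the same dimension, and $$\dim\ker(H-\lambda)=\dim(\ker(H-\lambda)\cap\mathcal H_{\mathrm{trv}})+\dim(\ker(H-\lambda)\cap\mathcal H_{\mathrm{alt}})+2\dim(\ker(H-\lambda)\cap\mathcal H_\omega),$$ so the eigenvalues of the restriction of $H$ to $\mathcal H_\omega$ enter the spectrum of $H$ with multiplicity two. -/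

import Mathlib

open MeasureTheory Matrix
open scoped ContDiff ENNReal


/-- The four fields of a beam: the lateral displacements `v` (along `k`) and `w` (along `j`), the
axial displacement `u` (along `i`) and the angular displacement `η` about the axis. -/
inductive BeamField : Type
  | v | w | u | η
  deriving DecidableEq

instance : Fintype BeamField := ⟨{.v, .w, .u, .η}, by intro x; cases x <;> decide⟩

/-- The two ends of a beam. -/
inductive BeamEnd : Type
  | origin | terminus
  deriving DecidableEq

instance : Fintype BeamEnd := ⟨{.origin, .terminus}, by intro x; cases x <;> decide⟩

/-- Beams of the antenna tower: the vertical antenna and three legs. -/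
inductive TowerEdge : Type
  | antenna
  | leg (s : ZMod 3)
  deriving DecidableEq, Fintype

/-- Joints of the antenna tower: the central joint, the top of the antenna and the feet of the
three legs. -/
inductive TowerVertex : Type
  | center | top
  | foot (s : ZMod 3)
  deriving DecidableEq

noncomputable section

/-! ### Sobolev calculus on one beam -/

/-- The Hilbert space `L²(0, ℓ)` of complex-valued functions on a beam of length `ℓ`. -/
abbrev EdgeL2 (l : ℝ) : Type := Lp ℂ 2 ((volume : Measure ℝ).restrict (Set.Ioo 0 l))

/-- `g` is the weak derivative of `f` on the open interval `(0, ℓ)`; both are in `L²(0, ℓ)`, so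
this says in particular that `f ∈ H¹(0, ℓ)`. -/
def IsWeakDeriv {l : ℝ} (f g : EdgeL2 l) : Prop :=
  ∀ φ : ℝ → ℝ, ContDiff ℝ ∞ φ → HasCompactSupport φ → tsupport φ ⊆ Set.Ioo 0 l →
    ∫ x in Set.Ioo 0 l, deriv φ x • f x = - ∫ x in Set.Ioo 0 l, φ x • g x

/-- `z` is the value at the point `x ∈ [0, ℓ]` of the continuous representative of `f` (which is
unique, and exists for every `f ∈ H¹(0, ℓ)`). -/
def IsTraceAt {l : ℝ} (f : EdgeL2 l) (x : ℝ) (z : ℂ) : Prop :=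
  ∃ F : ℝ → ℂ, ContinuousOn F (Set.Icc 0 l) ∧
    (∀ᵐ t ∂((volume : Measure ℝ).restrict (Set.Ioo 0 l)), f t = F t) ∧ F x = z

/-! ### Beam frames -/

/-- Order of the differential expression in each field: the operator domain is contained in
`H⁴ ⊕ H⁴ ⊕ H² ⊕ H²`. -/
def BeamField.order : BeamField → ℕ
  | .v => 4
  | .w => 4
  | .u => 2
  | .η => 2

/-- The signed incidence indicator. -/
def BeamEnd.sign : BeamEnd → ℂ
  | .origin => 1
  | .terminus => -1

/-- A beam frame with rigid joints: a geometric graph with a right-handed orthonormal local basis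
and positive stiffness constants on each beam. The joints in `clamped` are clamped (zero
displacement and rotation), all other joints are free rigid joints. -/
structure BeamFrame (V E : Type) where
  /-- positions of the joints -/
  pos : V → Fin 3 → ℝ
  /-- the joint at which a beam begins or ends -/
  endpoint : E → BeamEnd → V
  /-- lengths -/
  len : E → ℝ
  len_pos : ∀ e, 0 < len e
  /-- axial direction -/
  i : E → Fin 3 → ℝ
  /-- first principal axis of the cross-section -/
  j : E → Fin 3 → ℝ
  /-- second principal axis of the cross-section -/
  k : E → Fin 3 → ℝ
  j_unit : ∀ e, j e ⬝ᵥ j e = 1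
  k_unit : ∀ e, k e ⬝ᵥ k e = 1
  j_k : ∀ e, j e ⬝ᵥ k e = 0
  i_eq : ∀ e, i e = crossProduct (j e) (k e)
  pos_eq : ∀ e, pos (endpoint e .terminus) = pos (endpoint e .origin) + len e • i e
  /-- bending stiffness for `v` -/
  a : E → ℝ
  /-- bending stiffness for `w` -/
  b : E → ℝ
  /-- axial stiffness -/
  c : E → ℝ
  /-- angular displacement stiffness -/
  d : E → ℝ
  a_pos : ∀ e, 0 < a e
  b_pos : ∀ e, 0 < b e
  c_pos : ∀ e, 0 < c e
  d_pos : ∀ e, 0 < d e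
  /-- the clamped joints -/
  clamped : V → Prop

namespace BeamFrame

variable {V E : Type} (Γ : BeamFrame V E)

/-- The local basis vector along which a displacement field is measured; the angular displacement
`η` does not contribute to the displacement vector `u i + w j + v k`. -/
def dir (e : E) : BeamField → Fin 3 → ℝ
  | .v => Γ.k e
  | .w => Γ.j e
  | .u => Γ.i e
  | .η => 0

/-- The arc-length coordinate of an end of a beam. -/
def coord (e : E) : BeamEnd → ℝ
  | .origin => 0
  | .terminus => Γ.len e

/-- The coefficient of the highest derivative in the differential expression
`(v, w, u, η) ↦ (a v'''', b w'''', - c u'', - d η'')`. -/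
def coeff (e : E) : BeamField → ℝ
  | .v => Γ.a e
  | .w => Γ.b e
  | .u => - Γ.c e
  | .η => - Γ.d e

/-- The Hilbert space `L²(Γ)`: the orthogonal sum, over all beams and all four fields, of the
spaces `L²(0, ℓ_e)`. -/
abbrev L2 : Type := PiLp 2 (fun p : E × BeamField => EdgeL2 (Γ.len p.1))

/-- A family of boundary values: `β e ε f m` is the value, at the end `ε` of the beam `e`, of the
`m`-th derivative (in the direction `i e`) of the field `f`. -/
abbrev BdryValues (_ : BeamFrame V E) : Type := E → BeamEnd → BeamField → ℕ → ℂ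

/-- The displacement `u i + w j + v k` at an end of a beam. -/
def displacement (β : Γ.BdryValues) (e : E) (ε : BeamEnd) : Fin 3 → ℂ := fun n =>
  β e ε .u 0 * (Γ.i e n : ℂ) + β e ε .w 0 * (Γ.j e n : ℂ) + β e ε .v 0 * (Γ.k e n : ℂ)

/-- The (linearized) rotation vector `η i - v' j + w' k` at an end of a beam. -/
def rotation (β : Γ.BdryValues) (e : E) (ε : BeamEnd) : Fin 3 → ℂ := fun n =>
  β e ε .η 0 * (Γ.i e n : ℂ) - β e ε .v 1 * (Γ.j e n : ℂ) + β e ε .w 1 * (Γ.k e n : ℂ)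

/-- The force `c u' i - b w''' j - a v''' k` at an end of a beam. -/
def force (β : Γ.BdryValues) (e : E) (ε : BeamEnd) : Fin 3 → ℂ := fun n =>
  Γ.c e * β e ε .u 1 * (Γ.i e n : ℂ) - Γ.b e * β e ε .w 3 * (Γ.j e n : ℂ)
    - Γ.a e * β e ε .v 3 * (Γ.k e n : ℂ)

/-- The moment `d η' i - a v'' j + b w'' k` at an end of a beam. -/
def moment (β : Γ.BdryValues) (e : E) (ε : BeamEnd) : Fin 3 → ℂ := fun n =>
  Γ.d e * β e ε .η 1 * (Γ.i e n : ℂ) - Γ.a e * β e ε .v 2 * (Γ.j e n : ℂ)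
    + Γ.b e * β e ε .w 2 * (Γ.k e n : ℂ)

/-- `Ψ` has all the weak derivatives required by the Sobolev spaces `H⁴ ⊕ H⁴ ⊕ H² ⊕ H²`, namely
`D e f m` (the `m`-th derivative of the field `f` on the beam `e`), and `β` is the family of
boundary values of these derivatives below the top order. -/
structure IsJet (Ψ : Γ.L2) (D : (e : E) → BeamField → ℕ → EdgeL2 (Γ.len e))
    (β : Γ.BdryValues) : Prop where
  zero : ∀ e f, D e f 0 = Ψ (e, f)
  succ : ∀ e f m, m < f.order → IsWeakDeriv (D e f m) (D e f (m + 1))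
  bdry : ∀ e f m, m < f.order → ∀ ε, IsTraceAt (D e f m) (Γ.coord e ε) (β e ε f m)

/-- The joint conditions: continuity of displacement and rotation at every joint, balance of
forces and moments at every free joint, no displacement and no rotation at a clamped joint. -/
structure JointConditions [Fintype E] [DecidableEq V] (β : Γ.BdryValues) : Prop where
  displacement_eq : ∀ e ε e' ε', Γ.endpoint e ε = Γ.endpoint e' ε' →
    Γ.displacement β e ε = Γ.displacement β e' ε'
  rotation_eq : ∀ e ε e' ε', Γ.endpoint e ε = Γ.endpoint e' ε' →
    Γ.rotation β e ε = Γ.rotation β e' ε'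
  force_balance : ∀ x : V, ¬ Γ.clamped x →
    (∑ p : E × BeamEnd, if Γ.endpoint p.1 p.2 = x then p.2.sign • Γ.force β p.1 p.2 else 0) = 0
  moment_balance : ∀ x : V, ¬ Γ.clamped x →
    (∑ p : E × BeamEnd, if Γ.endpoint p.1 p.2 = x then p.2.sign • Γ.moment β p.1 p.2 else 0) = 0
  clamped_displacement : ∀ e ε, Γ.clamped (Γ.endpoint e ε) → Γ.displacement β e ε = 0
  clamped_rotation : ∀ e ε, Γ.clamped (Γ.endpoint e ε) → Γ.rotation β e ε = 0

variable {Γ}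

theorem IsTraceAt_add_smul {l : ℝ} {f g : EdgeL2 l} {x : ℝ} {y z : ℂ} (r s : ℂ)
    (hf : IsTraceAt f x y) (hg : IsTraceAt g x z) :
    IsTraceAt (r • f + s • g) x (r * y + s * z) := by
  obtain ⟨F, hF, hfF, rfl⟩ := hf
  obtain ⟨G, hG, hgG, rfl⟩ := hg
  refine ⟨fun t => r * F t + s * G t, by fun_prop, ?_, rfl⟩
  filter_upwards [hfF, hgG, Lp.coeFn_add (r • f) (s • g), Lp.coeFn_smul r f,
    Lp.coeFn_smul s g] with t h1 h2 h3 h4 h5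
  rw [h3, Pi.add_apply, h4, h5, Pi.smul_apply, Pi.smul_apply, h1, h2, smul_eq_mul, smul_eq_mul]

theorem integrable_smul_edge {l : ℝ} (f : EdgeL2 l) {φ : ℝ → ℝ} (hφ : Continuous φ)
    (hc : HasCompactSupport φ) :
    Integrable (fun x => φ x • f x) ((volume : Measure ℝ).restrict (Set.Ioo 0 l)) := by
  have hf : Integrable f ((volume : Measure ℝ).restrict (Set.Ioo 0 l)) :=
    (Lp.memLp f).integrable (by norm_num)
  obtain ⟨C, hC⟩ := hc.exists_bound_of_continuous hφ
  exact hf.bdd_smul C hφ.aestronglyMeasurable (Filter.Eventually.of_forall hC)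

theorem IsWeakDeriv_add_smul {l : ℝ} {f g f' g' : EdgeL2 l} (r s : ℂ)
    (hf : IsWeakDeriv f f') (hg : IsWeakDeriv g g') :
    IsWeakDeriv (r • f + s • g) (r • f' + s • g') := by
  intro φ h1 h2 h3
  have hφ : Continuous φ := h1.continuous
  have hφ' : Continuous (deriv φ) := h1.continuous_deriv (by simp)
  have key : ∀ (p q : EdgeL2 l) (ψ : ℝ → ℝ), Continuous ψ → HasCompactSupport ψ →
      ∫ x in Set.Ioo 0 l, ψ x • (r • p + s • q : EdgeL2 l) x =
        r * (∫ x in Set.Ioo 0 l, ψ x • p x) + s * ∫ x in Set.Ioo 0 l, ψ x • q x := by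
    intro p q ψ hψ hψc
    rw [← integral_const_mul, ← integral_const_mul, ← integral_add]
    · refine integral_congr_ae ?_
      filter_upwards [Lp.coeFn_add (r • p) (s • q), Lp.coeFn_smul r p,
        Lp.coeFn_smul s q] with t h3 h4 h5
      rw [h3, Pi.add_apply, h4, h5]
      simp only [Pi.smul_apply, smul_eq_mul, Complex.real_smul]
      ring
    · exact (integrable_smul_edge p hψ hψc).const_mul r
    · exact (integrable_smul_edge q hψ hψc).const_mul s
  rw [key _ _ _ hφ' h2.deriv, key _ _ _ hφ h2, hf φ h1 h2 h3, hg φ h1 h2 h3]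
  ring

/-- The weak derivative is unique. -/
theorem IsWeakDeriv_zero {l : ℝ} {g : EdgeL2 l} (h : IsWeakDeriv 0 g) : g = 0 := by
  have hg : Integrable g ((volume : Measure ℝ).restrict (Set.Ioo 0 l)) :=
    (Lp.memLp g).integrable (by norm_num)
  have hz : ∀ᵐ x ∂(volume : Measure ℝ), x ∈ Set.Ioo 0 l → g x = 0 := by
    refine isOpen_Ioo.ae_eq_zero_of_integral_contDiff_smul_eq_zero
      (IntegrableOn.locallyIntegrableOn hg) ?_
    intro φ h1 h2 h3
    have h4 := h φ h1 h2 h3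
    have h5 : ∫ x in Set.Ioo 0 l, deriv φ x • (0 : EdgeL2 l) x = 0 := by
      refine integral_eq_zero_of_ae ?_
      filter_upwards [Lp.coeFn_zero ℂ 2 ((volume : Measure ℝ).restrict (Set.Ioo 0 l))] with t ht
      exact (congrArg _ ht).trans (smul_zero _)
    rw [h5] at h4
    have h6 : ∫ x in Set.Ioo 0 l, φ x • g x = ∫ x, φ x • g x := by
      refine setIntegral_eq_integral_of_forall_compl_eq_zero ?_
      intro x hx
      have : φ x = 0 := by
        by_contra hne
        exact hx (h3 (subset_tsupport _ hne))
      simp [this]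
    rw [← h6]
    exact neg_eq_zero.mp h4.symm
  refine Lp.eq_zero_iff_ae_eq_zero.mpr ?_
  exact (ae_restrict_iff' measurableSet_Ioo).mpr hz

theorem IsJet.add_smul {Ψ Ψ' : Γ.L2} {D D' : (e : E) → BeamField → ℕ → EdgeL2 (Γ.len e)}
    {β β' : Γ.BdryValues} (r s : ℂ) (h : Γ.IsJet Ψ D β) (h' : Γ.IsJet Ψ' D' β') :
    Γ.IsJet (r • Ψ + s • Ψ') (fun e f m => r • D e f m + s • D' e f m)
      (fun e ε f m => r * β e ε f m + s * β' e ε f m) where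
  zero e f := by simp [h.zero, h'.zero]
  succ e f m hm := IsWeakDeriv_add_smul r s (h.succ e f m hm) (h'.succ e f m hm)
  bdry e f m hm ε := IsTraceAt_add_smul r s (h.bdry e f m hm ε) (h'.bdry e f m hm ε)

theorem JointConditions.add_smul [Fintype E] [DecidableEq V] {β β' : Γ.BdryValues} (r s : ℂ)
    (h : Γ.JointConditions β) (h' : Γ.JointConditions β') :
    Γ.JointConditions (fun e ε f m => r * β e ε f m + s * β' e ε f m) := by
  have hd : ∀ e ε, Γ.displacement (fun e ε f m => r * β e ε f m + s * β' e ε f m) e ε =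
      r • Γ.displacement β e ε + s • Γ.displacement β' e ε := by
    intro e ε; ext n; simp [displacement]; ring
  have hr : ∀ e ε, Γ.rotation (fun e ε f m => r * β e ε f m + s * β' e ε f m) e ε =
      r • Γ.rotation β e ε + s • Γ.rotation β' e ε := by
    intro e ε; ext n; simp [rotation]; ring
  have hf : ∀ e ε, Γ.force (fun e ε f m => r * β e ε f m + s * β' e ε f m) e ε =
      r • Γ.force β e ε + s • Γ.force β' e ε := by
    intro e ε; ext n; simp [force]; ring
  have hm : ∀ e ε, Γ.moment (fun e ε f m => r * β e ε f m + s * β' e ε f m) e ε =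
      r • Γ.moment β e ε + s • Γ.moment β' e ε := by
    intro e ε; ext n; simp [moment]; ring
  have hsum : ∀ (X Y : E → BeamEnd → Fin 3 → ℂ) (x : V),
      (∑ p : E × BeamEnd, if Γ.endpoint p.1 p.2 = x then p.2.sign • X p.1 p.2 else 0) = 0 →
      (∑ p : E × BeamEnd, if Γ.endpoint p.1 p.2 = x then p.2.sign • Y p.1 p.2 else 0) = 0 →
      (∑ p : E × BeamEnd, if Γ.endpoint p.1 p.2 = x then
        p.2.sign • (r • X p.1 p.2 + s • Y p.1 p.2) else 0) = 0 := by
    intro X Y x hX hY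
    have e1 := congrArg (fun t => r • t) hX
    have e2 := congrArg (fun t => s • t) hY
    simp only [Finset.smul_sum, smul_zero] at e1 e2
    have := congrArg₂ (· + ·) e1 e2
    simp only [← Finset.sum_add_distrib, add_zero] at this
    refine Eq.trans (Finset.sum_congr rfl fun p _ => ?_) this
    split_ifs
    · rw [smul_add, smul_comm r, smul_comm s]
    · simp
  constructor
  · intro e ε e' ε' he
    rw [hd, hd, h.displacement_eq e ε e' ε' he, h'.displacement_eq e ε e' ε' he]
  · intro e ε e' ε' he
    rw [hr, hr, h.rotation_eq e ε e' ε' he, h'.rotation_eq e ε e' ε' he]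
  · intro x hx
    simp only [hf]
    exact hsum _ _ x (h.force_balance x hx) (h'.force_balance x hx)
  · intro x hx
    simp only [hm]
    exact hsum _ _ x (h.moment_balance x hx) (h'.moment_balance x hx)
  · intro e ε he
    rw [hd, h.clamped_displacement e ε he, h'.clamped_displacement e ε he]; simp
  · intro e ε he
    rw [hr, h.clamped_rotation e ε he, h'.clamped_rotation e ε he]; simp

variable (Γ)

/-- `Ψ` lies in the domain of the Hamiltonian and is mapped to `Φ`: the fields are in
`H⁴ ⊕ H⁴ ⊕ H² ⊕ H²` on every beam, the joint conditions hold, and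
`Φ = (a v, b w, - c u'', - d η'')`. -/
def HamiltonianRel [Fintype E] [DecidableEq V] (Ψ Φ : Γ.L2) : Prop :=
  ∃ (D : (e : E) → BeamField → ℕ → EdgeL2 (Γ.len e)) (β : Γ.BdryValues),
    Γ.IsJet Ψ D β ∧ Γ.JointConditions β ∧
      ∀ e f, Φ (e, f) = (Γ.coeff e f : ℂ) • D e f f.order

theorem HamiltonianRel.add_smul [Fintype E] [DecidableEq V] {Ψ Φ Ψ' Φ' : Γ.L2} (r s : ℂ)
    (h : Γ.HamiltonianRel Ψ Φ) (h' : Γ.HamiltonianRel Ψ' Φ') :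
    Γ.HamiltonianRel (r • Ψ + s • Ψ') (r • Φ + s • Φ') := by
  obtain ⟨D, β, h1, h2, h3⟩ := h
  obtain ⟨D', β', h1', h2', h3'⟩ := h'
  refine ⟨_, _, h1.add_smul r s h1', h2.add_smul r s h2', ?_⟩
  intro e f
  simp only [PiLp.add_apply, PiLp.smul_apply, h3, h3', smul_add]
  rw [smul_comm r, smul_comm s]

theorem HamiltonianRel.zero [Fintype E] [DecidableEq V] : Γ.HamiltonianRel 0 0 := by
  refine ⟨fun _ _ _ => 0, fun _ _ _ _ => 0, ⟨by simp, ?_, ?_⟩, ?_, by simp⟩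
  · intro e f m _ φ _ _ _
    have : ∀ ψ : ℝ → ℝ, ∫ x in Set.Ioo 0 (Γ.len e), ψ x • (0 : EdgeL2 (Γ.len e)) x = 0 := by
      intro ψ
      refine integral_eq_zero_of_ae ?_
      filter_upwards [Lp.coeFn_zero ℂ 2
        ((volume : Measure ℝ).restrict (Set.Ioo 0 (Γ.len e)))] with t ht
      exact (congrArg _ ht).trans (smul_zero _)
    rw [this, this, neg_zero]
  · intro e f m _ ε
    exact ⟨0, continuousOn_const, Lp.coeFn_zero _ _ _, rfl⟩
  · have hd : ∀ e ε, Γ.displacement (fun _ _ _ _ => 0) e ε = 0 := by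
      intro e ε; ext n; simp [displacement]
    have hr : ∀ e ε, Γ.rotation (fun _ _ _ _ => 0) e ε = 0 := by
      intro e ε; ext n; simp [rotation]
    have hf : ∀ e ε, Γ.force (fun _ _ _ _ => 0) e ε = 0 := by
      intro e ε; ext n; simp [force]
    have hm : ∀ e ε, Γ.moment (fun _ _ _ _ => 0) e ε = 0 := by
      intro e ε; ext n; simp [moment]
    constructor <;> simp [hd, hr, hf, hm]

/-- The relation `HamiltonianRel` as a linear subspace of `L²(Γ) × L²(Γ)`. -/
def hamiltonianGraph [Fintype E] [DecidableEq V] : Submodule ℂ (Γ.L2 × Γ.L2) where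
  carrier := {p | Γ.HamiltonianRel p.1 p.2}
  zero_mem' := HamiltonianRel.zero Γ
  add_mem' {p q} hp hq := by simpa using HamiltonianRel.add_smul Γ 1 1 hp hq
  smul_mem' r p hp := by simpa using HamiltonianRel.add_smul Γ r 0 hp hp

theorem hamiltonianGraph_functional [Fintype E] [DecidableEq V] (p : Γ.L2 × Γ.L2)
    (hp : p ∈ Γ.hamiltonianGraph) (h0 : p.1 = 0) : p.2 = 0 := by
  obtain ⟨D, β, h1, -, h3⟩ := hp
  have hD : ∀ e f m, m ≤ f.order → D e f m = 0 := by
    intro e f m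
    induction m with
    | zero => intro _; rw [h1.zero, h0]; rfl
    | succ m ih =>
      intro hm
      have h4 := h1.succ e f m hm
      rw [ih (Nat.le_of_succ_le hm)] at h4
      exact IsWeakDeriv_zero h4
  refine PiLp.ext ?_
  rintro ⟨e, f⟩
  exact (h3 e f).trans (by rw [hD e f _ le_rfl]; simp)

/-- The Hamiltonian of the frame, as an unbounded operator on `L²(Γ)`. -/
def hamiltonian [Fintype E] [DecidableEq V] : Γ.L2 →ₗ.[ℂ] Γ.L2 :=
  Γ.hamiltonianGraph.toLinearPMap

/-- The operator `hamiltonian` is the one described by `HamiltonianRel`. -/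
theorem hamiltonian_spec [Fintype E] [DecidableEq V] (Ψ Φ : Γ.L2) :
    (∃ h : Ψ ∈ Γ.hamiltonian.domain, Γ.hamiltonian ⟨Ψ, h⟩ = Φ) ↔ Γ.HamiltonianRel Ψ Φ := by
  have key := Submodule.toLinearPMap_graph_eq Γ.hamiltonianGraph
    (fun p hp h0 => Γ.hamiltonianGraph_functional p hp h0)
  have h2 : (Ψ, Φ) ∈ Γ.hamiltonian.graph ↔ (Ψ, Φ) ∈ Γ.hamiltonianGraph := by
    rw [hamiltonian, key]
  rw [LinearPMap.mem_graph_iff] at h2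
  refine Iff.trans ?_ h2
  constructor
  · rintro ⟨h, rfl⟩
    exact ⟨⟨Ψ, h⟩, rfl, rfl⟩
  · rintro ⟨y, hy, h⟩
    obtain rfl : (y : Γ.L2) = Ψ := hy
    exact ⟨y.2, h⟩

/-- Complex conjugation of all fields. -/
def conj (Ψ : Γ.L2) : Γ.L2 := WithLp.toLp 2 fun p => star (Ψ p)

end BeamFrame

/-! ### Reducing decompositions -/

section Reducing

variable {F ι : Type*} [NormedAddCommGroup F] [InnerProductSpace ℂ F]

/-- The (possibly unbounded) operator `H` is reduced by the orthogonal decomposition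
`F = ⨁ ρ, K ρ`: the summands are closed (they have orthogonal projections), mutually orthogonal
and span `F`, each of them is invariant under `H`, the domain is the sum of its intersections with
the summands, and `H` commutes with the orthogonal projectors. -/
structure IsReducedBy (H : F →ₗ.[ℂ] F) (K : ι → Submodule ℂ F) : Prop where
  hasProj : ∀ ρ, (K ρ).HasOrthogonalProjection
  orthogonal : OrthogonalFamily ℂ (fun ρ => K ρ) (fun ρ => (K ρ).subtypeₗᵢ)
  span : (⨆ ρ, K ρ) = ⊤
  invariant : ∀ ρ, ∀ x : H.domain, (x : F) ∈ K ρ → H x ∈ K ρ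
  domain : H.domain = ⨆ ρ, K ρ ⊓ H.domain
  commute : ∀ ρ, ∀ x : H.domain, ∃ h : (K ρ).starProjection (x : F) ∈ H.domain,
    H ⟨(K ρ).starProjection (x : F), h⟩ = (K ρ).starProjection (H x)

/-- The eigenspace of an unbounded operator. -/
def unboundedEigenspace (H : F →ₗ.[ℂ] F) (z : ℂ) : Submodule ℂ F where
  carrier := {x | ∃ h : x ∈ H.domain, H ⟨x, h⟩ = z • x}
  zero_mem' := ⟨H.domain.zero_mem, by
    rw [smul_zero]; exact H.map_zero⟩
  add_mem' := by
    rintro x y ⟨hx, ex⟩ ⟨hy, ey⟩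
    refine ⟨H.domain.add_mem hx hy, ?_⟩
    have := H.map_add ⟨x, hx⟩ ⟨y, hy⟩
    rw [ex, ey, ← smul_add] at this
    exact this
  smul_mem' := by
    rintro r x ⟨hx, ex⟩
    refine ⟨H.domain.smul_mem r hx, ?_⟩
    have := H.map_smul r ⟨x, hx⟩
    rw [ex, smul_comm] at this
    exact this

end Reducing

/-! ### The dihedral group of order six and its representations -/

/-- The sum of all copies of the irreducible representation `ρ` that are contained in the
representation `π`. -/
def isotypicPart {G W F : Type*} [Group G] [AddCommGroup W] [Module ℂ W] [AddCommGroup F]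
    [Module ℂ F] (ρ : Representation ℂ G W) (π : Representation ℂ G F) : Submodule ℂ F :=
  ⨆ φ : ρ.IntertwiningMap π, LinearMap.range φ.toLinearMap

/-- The homomorphism from the dihedral group `⟨R, F | R³ = F² = F R F R = 1⟩` given by the images
of its generators `R = r 1` and `F = sr 0`. -/
def dihedralLift {M : Type*} [Monoid M] (R F : M) (hR : R ^ 3 = 1) (hF : F ^ 2 = 1)
    (hFR : F * R * F * R = 1) : DihedralGroup 3 →* M where
  toFun
    | .r i => R ^ i.val
    | .sr i => F * R ^ i.val
  map_one' := by
    change R ^ (0 : ZMod 3).val = 1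
    simp
  map_mul' := by
    have hadd : ∀ i j : ZMod 3, R ^ (i + j).val = R ^ i.val * R ^ j.val := by
      intro i j
      rw [ZMod.val_add, ← pow_add, ← pow_eq_pow_mod _ hR]
    have hF' : F * F = 1 := by rw [← sq, hF]
    have hR2 : R * R ^ 2 = 1 := by rw [← pow_succ', hR]
    have hRF : R * F = F * R ^ 2 := by
      calc R * F = (F * F) * (R * F) * (R * R ^ 2) := by rw [hF', hR2]; simp
        _ = F * (F * R * F * R) * R ^ 2 := by simp only [mul_assoc]
        _ = F * R ^ 2 := by rw [hFR, mul_one]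
    have hpow : ∀ n : ℕ, R ^ n * F = F * (R ^ 2) ^ n := by
      intro n
      induction n with
      | zero => simp
      | succ n ih => rw [pow_succ, mul_assoc, hRF, ← mul_assoc, ih, mul_assoc, ← pow_succ]
    have hneg : ∀ i : ZMod 3, R ^ i.val * F = F * R ^ (-i).val := by
      intro i
      rw [hpow, ← pow_mul, pow_eq_pow_mod _ hR]
      congr 2
      revert i
      decide
    rintro (i | i) (j | j)
    · exact hadd i j
    · change F * R ^ (j - i).val = R ^ i.val * (F * R ^ j.val)
      rw [← mul_assoc, hneg, mul_assoc, ← hadd, neg_add_eq_sub]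
    · change F * R ^ (i + j).val = F * R ^ i.val * R ^ j.val
      rw [mul_assoc, hadd]
    · change R ^ (j - i).val = F * R ^ i.val * (F * R ^ j.val)
      rw [mul_assoc, ← mul_assoc (R ^ i.val), hneg, mul_assoc F, ← mul_assoc F, hF', one_mul,
        ← hadd, neg_add_eq_sub]

/-- The rotation by `2π/3` about the vertical axis. -/
def rotMatrix : Matrix (Fin 3) (Fin 3) ℝ :=
  !![Real.cos (2 * Real.pi / 3), - Real.sin (2 * Real.pi / 3), 0;
     Real.sin (2 * Real.pi / 3), Real.cos (2 * Real.pi / 3), 0;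
     0, 0, 1]

/-- The reflection in the vertical plane spanned by the antenna and the first leg. -/
def reflMatrix : Matrix (Fin 3) (Fin 3) ℝ :=
  !![1, 0, 0; 0, -1, 0; 0, 0, 1]

theorem cos_third : Real.cos (2 * Real.pi / 3) = -1 / 2 := by
  rw [show 2 * Real.pi / 3 = Real.pi - Real.pi / 3 by ring, Real.cos_pi_sub, Real.cos_pi_div_three]
  norm_num

theorem sin_third_sq : Real.sin (2 * Real.pi / 3) * Real.sin (2 * Real.pi / 3) = 3 / 4 := by
  have := Real.sin_sq_add_cos_sq (2 * Real.pi / 3)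
  rw [cos_third] at this
  linarith

theorem rotMatrix_cube : rotMatrix ^ 3 = 1 := by
  have h := sin_third_sq
  rw [pow_succ, pow_two, rotMatrix, cos_third]
  set s := Real.sin (2 * Real.pi / 3)
  ext a b
  fin_cases a <;> fin_cases b <;>
    simp [Matrix.mul_apply, Fin.sum_univ_three] <;> first | linear_combination (3 / 2) * h | linear_combination (-s) * h | linear_combination s * h

theorem reflMatrix_sq : reflMatrix ^ 2 = 1 := by
  rw [pow_two, reflMatrix]
  ext a b
  fin_cases a <;> fin_cases b <;> simp [Matrix.mul_apply, Fin.sum_univ_three]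

theorem refl_rot : reflMatrix * rotMatrix * reflMatrix * rotMatrix = 1 := by
  have h := sin_third_sq
  rw [reflMatrix, rotMatrix, cos_third]
  set s := Real.sin (2 * Real.pi / 3)
  ext a b
  fin_cases a <;> fin_cases b <;>
    simp [Matrix.mul_apply, Fin.sum_univ_three] <;> first | linear_combination h | ring

/-- The alternating representation: `R ↦ 1`, `F ↦ -1`. -/
def altRep : Representation ℂ (DihedralGroup 3) ℂ :=
  dihedralLift 1 (-1) (by simp) (by simp) (by simp)

/-- The horizontal block, over `ℂ`, of a matrix of size three. -/
def horizontalBlock (T : Matrix (Fin 3) (Fin 3) ℝ) : Matrix (Fin 2) (Fin 2) ℂ :=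
  (T.submatrix Fin.castSucc Fin.castSucc).map (fun x : ℝ => (x : ℂ))

theorem horizontalBlock_mul (S T : Matrix (Fin 3) (Fin 3) ℝ) (h0 : S 0 2 = 0) (h1 : S 1 2 = 0) :
    horizontalBlock (S * T) = horizontalBlock S * horizontalBlock T := by
  ext a b
  fin_cases a <;> fin_cases b <;>
    simp [horizontalBlock, Matrix.mul_apply, Fin.sum_univ_three, h0, h1]

theorem horizontalBlock_one : horizontalBlock 1 = 1 := by
  ext a b
  fin_cases a <;> fin_cases b <;> simp [horizontalBlock]

/-- The standard representation: the symmetries of an equilateral triangle, acting on `ℂ²`. -/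
def stdRep : Representation ℂ (DihedralGroup 3) (Fin 2 → ℂ) :=
  dihedralLift (Matrix.toLinAlgEquiv' (horizontalBlock rotMatrix))
    (Matrix.toLinAlgEquiv' (horizontalBlock reflMatrix))
    (by
      rw [← map_pow, ← map_one Matrix.toLinAlgEquiv', ← horizontalBlock_one, ← rotMatrix_cube,
        pow_three, pow_three, horizontalBlock_mul, horizontalBlock_mul] <;> simp [rotMatrix])
    (by
      rw [← map_pow, ← map_one Matrix.toLinAlgEquiv', ← horizontalBlock_one, ← reflMatrix_sq,
        pow_two, pow_two, horizontalBlock_mul] <;> simp [reflMatrix])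
    (by
      rw [← map_mul, ← map_mul, ← map_mul, ← map_one Matrix.toLinAlgEquiv', ← horizontalBlock_one,
        ← refl_rot, mul_assoc, mul_assoc, mul_assoc, mul_assoc, horizontalBlock_mul,
        horizontalBlock_mul, horizontalBlock_mul] <;> simp [rotMatrix, reflMatrix])

/-! ### The antenna tower -/

/-- The parameters of the antenna tower: lengths of the antenna and of the legs, inclination of
the legs, and stiffness constants of the antenna (with equal bending stiffness in both principal
directions) and of the three identical legs. -/
structure AntennaTower where
  antennaLen : ℝ
  legLen : ℝ
  inclination : ℝ
  a₀ : ℝ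
  c₀ : ℝ
  d₀ : ℝ
  a : ℝ
  b : ℝ
  c : ℝ
  d : ℝ
  antennaLen_pos : 0 < antennaLen
  legLen_pos : 0 < legLen
  a₀_pos : 0 < a₀
  c₀_pos : 0 < c₀
  d₀_pos : 0 < d₀
  a_pos : 0 < a
  b_pos : 0 < b
  c_pos : 0 < c
  d_pos : 0 < d

theorem rotMatrix_dot (x y : Fin 3 → ℝ) : (rotMatrix *ᵥ x) ⬝ᵥ (rotMatrix *ᵥ y) = x ⬝ᵥ y := by
  have h := Real.sin_sq_add_cos_sq (2 * Real.pi / 3)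
  simp only [rotMatrix, dotProduct, Matrix.mulVec, Fin.sum_univ_three, Matrix.of_apply,
    Matrix.cons_val]
  linear_combination (x 0 * y 0 + x 1 * y 1) * h

theorem rotMatrix_cross (x y : Fin 3 → ℝ) :
    crossProduct (rotMatrix *ᵥ x) (rotMatrix *ᵥ y) = rotMatrix *ᵥ crossProduct x y := by
  have h := Real.sin_sq_add_cos_sq (2 * Real.pi / 3)
  ext n
  fin_cases n <;>
    simp [rotMatrix, cross_apply, dotProduct, Matrix.mulVec, Fin.sum_univ_three] <;>
    first | ring1 | linear_combination (x 0 * y 1 - x 1 * y 0) * h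

theorem rotMatrix_pow_dot (n : ℕ) (x y : Fin 3 → ℝ) :
    (rotMatrix ^ n *ᵥ x) ⬝ᵥ (rotMatrix ^ n *ᵥ y) = x ⬝ᵥ y := by
  induction n with
  | zero => simp
  | succ n ih => rw [pow_succ', ← Matrix.mulVec_mulVec, ← Matrix.mulVec_mulVec, rotMatrix_dot, ih]

theorem rotMatrix_pow_cross (n : ℕ) (x y : Fin 3 → ℝ) :
    crossProduct (rotMatrix ^ n *ᵥ x) (rotMatrix ^ n *ᵥ y) =
      rotMatrix ^ n *ᵥ crossProduct x y := by
  induction n with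
  | zero => simp
  | succ n ih =>
    rw [pow_succ', ← Matrix.mulVec_mulVec, ← Matrix.mulVec_mulVec, rotMatrix_cross, ih,
      Matrix.mulVec_mulVec]

namespace AntennaTower

variable (A : AntennaTower)

/-- Axial directions: the antenna points down, the first leg points up towards the central joint
in the half-plane of the first horizontal axis, the others are obtained by rotation. -/
def axial : TowerEdge → Fin 3 → ℝ
  | .antenna => ![0, 0, -1]
  | .leg s => rotMatrix ^ s.val *ᵥ ![Real.cos A.inclination, 0, Real.sin A.inclination]

/-- The first principal axes; they are horizontal. -/
def principal₁ : TowerEdge → Fin 3 → ℝ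
  | .antenna => ![0, 1, 0]
  | .leg s => rotMatrix ^ s.val *ᵥ ![0, 1, 0]

/-- The second principal axes. -/
def principal₂ : TowerEdge → Fin 3 → ℝ
  | .antenna => ![1, 0, 0]
  | .leg s => rotMatrix ^ s.val *ᵥ ![- Real.sin A.inclination, 0, Real.cos A.inclination]

/-- A quantity depending on the type of beam only. -/
def onBeams {X : Type} (x y : X) : TowerEdge → X
  | .antenna => x
  | .leg _ => y

/-- The antenna tower as a beam frame. The legs run from the clamped feet to the central joint, the
antenna from its free top to the central joint. The legs `0`, `1`, `2` are the first, second and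
third leg. -/
def frame : BeamFrame TowerVertex TowerEdge where
  pos
    | .center => 0
    | .top => ![0, 0, A.antennaLen]
    | .foot s => - A.legLen • A.axial (.leg s)
  endpoint
    | .antenna, .origin => .top
    | .leg s, .origin => .foot s
    | _, .terminus => .center
  len := onBeams A.antennaLen A.legLen
  len_pos := by rintro (_ | s); exacts [A.antennaLen_pos, A.legLen_pos]
  i := A.axial
  j := principal₁
  k := A.principal₂
  j_unit := by
    rintro (_ | s)
    · simp [principal₁]
    · simp [principal₁, rotMatrix_pow_dot]
  k_unit := by
    rintro (_ | s)
    · simp [principal₂]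
    · simp only [principal₂, rotMatrix_pow_dot]
      simp [← sq]
  j_k := by
    rintro (_ | s)
    · simp [principal₁, principal₂]
    · simp [principal₁, principal₂, rotMatrix_pow_dot]
  i_eq := by
    rintro (_ | s)
    · simp [axial, principal₁, principal₂, cross_apply]
    · simp only [axial, principal₁, principal₂, rotMatrix_pow_cross]
      simp [cross_apply]
  pos_eq := by
    rintro (_ | s)
    · ext n
      fin_cases n <;> simp [axial, onBeams]
    · simp [onBeams]
  a := onBeams A.a₀ A.a
  b := onBeams A.a₀ A.b
  c := onBeams A.c₀ A.c
  d := onBeams A.d₀ A.d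
  a_pos := by rintro (_ | s); exacts [A.a₀_pos, A.a_pos]
  b_pos := by rintro (_ | s); exacts [A.a₀_pos, A.b_pos]
  c_pos := by rintro (_ | s); exacts [A.c₀_pos, A.c_pos]
  d_pos := by rintro (_ | s); exacts [A.d₀_pos, A.d_pos]
  clamped
    | .foot _ => True
    | _ => False

/-- A field of the antenna. -/
def ant (f : BeamField) (Ψ : A.frame.L2) : EdgeL2 A.antennaLen := Ψ (.antenna, f)

/-- A field of a leg. -/
def leg (s : ZMod 3) (f : BeamField) (Ψ : A.frame.L2) : EdgeL2 A.legLen := Ψ (.leg s, f)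

/-- The element of `L²(Γ)` with given fields on the antenna and on the legs. -/
def ofFields (X : BeamField → EdgeL2 A.antennaLen) (Y : ZMod 3 → BeamField → EdgeL2 A.legLen) :
    A.frame.L2 :=
  WithLp.toLp 2 fun
    | (.antenna, f) => X f
    | (.leg s, f) => Y s f

@[simp] theorem ant_ofFields (X : BeamField → EdgeL2 A.antennaLen)
    (Y : ZMod 3 → BeamField → EdgeL2 A.legLen) (f : BeamField) :
    A.ant f (A.ofFields X Y) = X f := rfl

@[simp] theorem leg_ofFields (X : BeamField → EdgeL2 A.antennaLen)
    (Y : ZMod 3 → BeamField → EdgeL2 A.legLen) (s : ZMod 3) (f : BeamField) :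
    A.leg s f (A.ofFields X Y) = Y s f := rfl

theorem fields_ext {Ψ Φ : A.frame.L2} (h : ∀ f, A.ant f Ψ = A.ant f Φ)
    (h' : ∀ s f, A.leg s f Ψ = A.leg s f Φ) : Ψ = Φ := by
  refine PiLp.ext ?_
  rintro ⟨_ | s, f⟩
  · exact h f
  · exact h' s f

@[simp] theorem ant_add (f : BeamField) (Ψ Φ : A.frame.L2) :
    A.ant f (Ψ + Φ) = A.ant f Ψ + A.ant f Φ := rfl

@[simp] theorem ant_smul (f : BeamField) (r : ℂ) (Ψ : A.frame.L2) :
    A.ant f (r • Ψ) = r • A.ant f Ψ := rfl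

@[simp] theorem ant_zero (f : BeamField) : A.ant f 0 = 0 := rfl

@[simp] theorem leg_add (s : ZMod 3) (f : BeamField) (Ψ Φ : A.frame.L2) :
    A.leg s f (Ψ + Φ) = A.leg s f Ψ + A.leg s f Φ := rfl

@[simp] theorem leg_smul (s : ZMod 3) (f : BeamField) (r : ℂ) (Ψ : A.frame.L2) :
    A.leg s f (r • Ψ) = r • A.leg s f Ψ := rfl

@[simp] theorem leg_zero (s : ZMod 3) (f : BeamField) : A.leg s f 0 = 0 := rfl

/-- The subspace of the fully symmetric states. -/
def trv : Submodule ℂ A.frame.L2 where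
  carrier := {Ψ | A.ant .v Ψ = 0 ∧ A.ant .w Ψ = 0 ∧ A.ant .η Ψ = 0 ∧
    (∀ s, A.leg s .w Ψ = 0 ∧ A.leg s .η Ψ = 0) ∧
    A.leg 0 .v Ψ = A.leg 1 .v Ψ ∧ A.leg 1 .v Ψ = A.leg 2 .v Ψ ∧
    A.leg 0 .u Ψ = A.leg 1 .u Ψ ∧ A.leg 1 .u Ψ = A.leg 2 .u Ψ}
  zero_mem' := by simp
  add_mem' := by
    rintro Ψ Φ ⟨h1, h2, h3, h4, h5, h6, h7, h8⟩ ⟨g1, g2, g3, g4, g5, g6, g7, g8⟩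
    simp [h1, h2, h3, h4, h5, h6, h7, h8, g1, g2, g3, g4, g5, g6, g7, g8]
  smul_mem' := by
    rintro r Ψ ⟨h1, h2, h3, h4, h5, h6, h7, h8⟩
    simp [h1, h2, h3, h4, h5, h6, h7, h8]

/-- The subspace of the alternating states. -/
def alt : Submodule ℂ A.frame.L2 where
  carrier := {Ψ | A.ant .v Ψ = 0 ∧ A.ant .w Ψ = 0 ∧ A.ant .u Ψ = 0 ∧
    (∀ s, A.leg s .u Ψ = 0 ∧ A.leg s .v Ψ = 0) ∧
    A.leg 0 .w Ψ = A.leg 1 .w Ψ ∧ A.leg 1 .w Ψ = A.leg 2 .w Ψ ∧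
    A.leg 0 .η Ψ = A.leg 1 .η Ψ ∧ A.leg 1 .η Ψ = A.leg 2 .η Ψ}
  zero_mem' := by simp
  add_mem' := by
    rintro Ψ Φ ⟨h1, h2, h3, h4, h5, h6, h7, h8⟩ ⟨g1, g2, g3, g4, g5, g6, g7, g8⟩
    simp [h1, h2, h3, h4, h5, h6, h7, h8, g1, g2, g3, g4, g5, g6, g7, g8]
  smul_mem' := by
    rintro r Ψ ⟨h1, h2, h3, h4, h5, h6, h7, h8⟩
    simp [h1, h2, h3, h4, h5, h6, h7, h8]

/-- The subspace given by `u₀ = η₀ = 0`, `w₀ = κ v₀`, `Ψ₃ = ζ Ψ₂ = ζ² Ψ₁`. -/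
def wobble (κ ζ : ℂ) : Submodule ℂ A.frame.L2 where
  carrier := {Ψ | A.ant .u Ψ = 0 ∧ A.ant .η Ψ = 0 ∧ A.ant .w Ψ = κ • A.ant .v Ψ ∧
    ∀ f, A.leg 2 f Ψ = ζ • A.leg 1 f Ψ ∧ ζ • A.leg 1 f Ψ = ζ ^ 2 • A.leg 0 f Ψ}
  zero_mem' := by simp
  add_mem' := by
    rintro Ψ Φ ⟨h1, h2, h3, h4⟩ ⟨g1, g2, g3, g4⟩
    refine ⟨by simp [h1, g1], by simp [h2, g2], by simp [h3, g3], fun f => ⟨?_, ?_⟩⟩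
    · simp [(h4 f).1, (g4 f).1]
    · simp [(h4 f).2, (g4 f).2]
  smul_mem' := by
    rintro r Ψ ⟨h1, h2, h3, h4⟩
    refine ⟨by simp [h1], by simp [h2], by simp [h3, smul_comm r], fun f => ⟨?_, ?_⟩⟩
    · rw [leg_smul, leg_smul, (h4 f).1, smul_comm]
    · rw [leg_smul, leg_smul, smul_comm, (h4 f).2, smul_comm]

/-- `ω = exp(2 π i / 3)`. -/
def omega : ℂ := Complex.exp (2 * Real.pi * Complex.I / 3)

/-- The subspace `H_ω`. -/
def wob : Submodule ℂ A.frame.L2 := A.wobble Complex.I omega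

/-- The subspace `H_ω̄`. -/
def wobBar : Submodule ℂ A.frame.L2 := A.wobble (-Complex.I) (star omega)

/-! ### The action of the symmetry group on the fields -/

/-- The matrix by which an orthogonal transformation `T`, mapping the beam `e` to the beam `e'`,
acts on the fields: displacement vectors `u i + w j + v k` are mapped by `T`, and the angular
displacement is multiplied by `det T`, since rotations are conjugated by `T`. -/
def fieldMatrix (T : Matrix (Fin 3) (Fin 3) ℝ) (e' e : TowerEdge) :
    Matrix BeamField BeamField ℝ :=
  Matrix.of (fun f => A.frame.dir e' f) * T * (Matrix.of (fun f => A.frame.dir e f))ᵀ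
    + T.det • Matrix.single .η .η 1

/-- The action on `L²(Γ)` of an orthogonal transformation `T` which fixes the antenna and maps the
leg `s` to the leg `τ s`. -/
def act (T : Matrix (Fin 3) (Fin 3) ℝ) (τ : Equiv.Perm (ZMod 3)) :
    A.frame.L2 →ₗ[ℂ] A.frame.L2 where
  toFun Ψ := A.ofFields
    (fun f => ∑ f', (A.fieldMatrix T .antenna .antenna f f' : ℂ) • A.ant f' Ψ)
    (fun s f => ∑ f', (A.fieldMatrix T (.leg s) (.leg (τ.symm s)) f f' : ℂ) •
      A.leg (τ.symm s) f' Ψ)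
  map_add' Ψ Φ := by
    apply A.fields_ext <;> intros <;> simp only [ant_ofFields, leg_ofFields, ant_add, leg_add,
      smul_add, Finset.sum_add_distrib]
  map_smul' r Ψ := by
    apply A.fields_ext <;> intros <;> simp only [ant_ofFields, leg_ofFields, ant_smul, leg_smul,
      Finset.smul_sum, RingHom.id_apply] <;> exact Finset.sum_congr rfl fun _ _ => smul_comm _ _ _

/-- The matrix whose rows are the directions of the four fields. -/
abbrev dirMatrix (e : TowerEdge) : Matrix BeamField (Fin 3) ℝ :=
  Matrix.of (fun f => A.frame.dir e f)

theorem sum_fields {X : Type*} [AddCommMonoid X] (g : BeamField → X) :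
    ∑ f, g f = g .v + (g .w + (g .u + g .η)) := by
  have : (Finset.univ : Finset BeamField) = {.v, .w, .u, .η} := rfl
  rw [this, Finset.sum_insert (by decide), Finset.sum_insert (by decide),
    Finset.sum_insert (by decide), Finset.sum_singleton]

theorem dirMatrix_mul_transpose (e : TowerEdge) :
    A.dirMatrix e * (A.dirMatrix e)ᵀ + Matrix.single .η .η 1 = 1 := by
  have h1 := A.frame.j_unit e
  have h2 := A.frame.k_unit e
  have h3 := A.frame.j_k e
  have h4 := A.frame.i_eq e
  have h5 : A.frame.i e ⬝ᵥ A.frame.i e = 1 := by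
    rw [h4, cross_dot_cross, h1, h2, h3, dotProduct_comm, h3]; ring
  have h6 : A.frame.j e ⬝ᵥ A.frame.i e = 0 := by rw [h4, dot_self_cross]
  have h7 : A.frame.k e ⬝ᵥ A.frame.i e = 0 := by rw [h4, dot_cross_self]
  have h8 : A.frame.i e ⬝ᵥ A.frame.j e = 0 := by rw [dotProduct_comm, h6]
  have h9 : A.frame.i e ⬝ᵥ A.frame.k e = 0 := by rw [dotProduct_comm, h7]
  have h10 : A.frame.k e ⬝ᵥ A.frame.j e = 0 := by rw [dotProduct_comm, h3]
  clear h4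
  ext f f'
  have : (A.dirMatrix e * (A.dirMatrix e)ᵀ) f f' = A.frame.dir e f ⬝ᵥ A.frame.dir e f' := rfl
  rw [Matrix.add_apply, this]
  cases f <;> cases f' <;> simp [BeamFrame.dir, *]

theorem transpose_mul_dirMatrix (e : TowerEdge) :
    (A.dirMatrix e)ᵀ * A.dirMatrix e = 1 := by
  let C : Matrix (Fin 3) (Fin 3) ℝ := ![A.frame.k e, A.frame.j e, A.frame.i e]
  have h := A.dirMatrix_mul_transpose e
  have hC : C * Cᵀ = 1 := by
    have key : ∀ f f', A.frame.dir e f ⬝ᵥ A.frame.dir e f' +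
        (Matrix.single BeamField.η BeamField.η (1 : ℝ)) f f' =
        (1 : Matrix BeamField BeamField ℝ) f f' := fun f f' => congrFun (congrFun h f) f'
    ext a b
    have e2 : (C * Cᵀ) a b = C a ⬝ᵥ C b := rfl
    rw [e2]
    fin_cases a <;> fin_cases b
    · simpa [BeamFrame.dir, C] using key .v .v
    · simpa [BeamFrame.dir, C] using key .v .w
    · simpa [BeamFrame.dir, C] using key .v .u
    · simpa [BeamFrame.dir, C] using key .w .v
    · simpa [BeamFrame.dir, C] using key .w .w
    · simpa [BeamFrame.dir, C] using key .w .u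
    · simpa [BeamFrame.dir, C] using key .u .v
    · simpa [BeamFrame.dir, C] using key .u .w
    · simpa [BeamFrame.dir, C] using key .u .u
  have hC' : Cᵀ * C = 1 := mul_eq_one_comm.mp hC
  rw [← hC']
  ext m n
  rw [Matrix.mul_apply, Matrix.mul_apply, sum_fields, Fin.sum_univ_three]
  simp only [Matrix.transpose_apply, Matrix.of_apply, BeamFrame.dir, Pi.zero_apply, mul_zero,
    add_zero, ← add_assoc]
  rfl

theorem single_mul_dirMatrix (e : TowerEdge) :
    Matrix.single BeamField.η BeamField.η (1 : ℝ) * A.dirMatrix e = 0 := by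
  ext f n
  cases f <;> simp [Matrix.mul_apply, Matrix.single, BeamFrame.dir]

theorem transpose_mul_single (e : TowerEdge) :
    (A.dirMatrix e)ᵀ * Matrix.single BeamField.η BeamField.η (1 : ℝ) = 0 := by
  have h := congrArg Matrix.transpose (A.single_mul_dirMatrix e)
  rwa [Matrix.transpose_mul, Matrix.transpose_single, Matrix.transpose_zero] at h

theorem fieldMatrix_mul (S T : Matrix (Fin 3) (Fin 3) ℝ) (e'' e' e : TowerEdge) :
    A.fieldMatrix S e'' e' * A.fieldMatrix T e' e = A.fieldMatrix (S * T) e'' e := by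
  change (A.dirMatrix e'' * S * (A.dirMatrix e')ᵀ + S.det • Matrix.single .η .η 1) *
    (A.dirMatrix e' * T * (A.dirMatrix e)ᵀ + T.det • Matrix.single .η .η 1) =
    A.dirMatrix e'' * (S * T) * (A.dirMatrix e)ᵀ + (S * T).det • Matrix.single .η .η 1
  have t1 : A.dirMatrix e'' * S * (A.dirMatrix e')ᵀ * (A.dirMatrix e' * T * (A.dirMatrix e)ᵀ) =
      A.dirMatrix e'' * (S * T) * (A.dirMatrix e)ᵀ := by
    calc _ = A.dirMatrix e'' * S * ((A.dirMatrix e')ᵀ * A.dirMatrix e') * T *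
          (A.dirMatrix e)ᵀ := by simp only [Matrix.mul_assoc]
      _ = _ := by rw [transpose_mul_dirMatrix, Matrix.mul_one]; simp only [Matrix.mul_assoc]
  have t2 : Matrix.single BeamField.η BeamField.η (1 : ℝ) *
      (A.dirMatrix e' * T * (A.dirMatrix e)ᵀ) = 0 := by
    rw [← Matrix.mul_assoc, ← Matrix.mul_assoc, single_mul_dirMatrix]; simp
  have t3 : A.dirMatrix e'' * S * (A.dirMatrix e')ᵀ *
      Matrix.single BeamField.η BeamField.η (1 : ℝ) = 0 := by
    rw [Matrix.mul_assoc, transpose_mul_single, Matrix.mul_zero]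
  rw [add_mul, mul_add, mul_add, t1, Matrix.mul_smul, t3, Matrix.smul_mul, t2, Matrix.smul_mul,
    Matrix.mul_smul, Matrix.single_mul_single_same, Matrix.det_mul, smul_smul]
  simp

theorem act_act (S T : Matrix (Fin 3) (Fin 3) ℝ) (σ τ : Equiv.Perm (ZMod 3)) :
    A.act S σ * A.act T τ = A.act (S * T) (σ * τ) := by
  have key : ∀ {l : ℝ} (e'' e' e : TowerEdge) (X : BeamField → EdgeL2 l) (f : BeamField),
      ∑ f', (A.fieldMatrix S e'' e' f f' : ℂ) • (∑ g, (A.fieldMatrix T e' e f' g : ℂ) • X g) =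
        ∑ g, (A.fieldMatrix (S * T) e'' e f g : ℂ) • X g := by
    intro l e'' e' e X f
    simp only [Finset.smul_sum, smul_smul]
    rw [Finset.sum_comm]
    refine Finset.sum_congr rfl fun g _ => ?_
    rw [← Finset.sum_smul, ← fieldMatrix_mul A S T e'' e' e, Matrix.mul_apply]
    push_cast
    rfl
  refine LinearMap.ext fun Ψ => A.fields_ext ?_ ?_
  · intro f
    exact key .antenna .antenna .antenna (fun g => A.ant g Ψ) f
  · intro s f
    exact key (.leg s) (.leg (σ.symm s)) (.leg (τ.symm (σ.symm s)))
      (fun g => A.leg (τ.symm (σ.symm s)) g Ψ) f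

theorem act_one : A.act 1 1 = 1 := by
  have h1 : ∀ e, A.fieldMatrix 1 e e = 1 := by
    intro e
    rw [fieldMatrix, Matrix.det_one, Matrix.mul_one, one_smul]
    exact A.dirMatrix_mul_transpose e
  have key : ∀ {l : ℝ} (e : TowerEdge) (X : BeamField → EdgeL2 l) (f : BeamField),
      ∑ f', (A.fieldMatrix 1 e e f f' : ℂ) • X f' = X f := by
    intro l e X f
    rw [h1, Finset.sum_eq_single f]
    · simp
    · intro g _ hg
      simp [Matrix.one_apply_ne hg.symm]
    · simp
  refine LinearMap.ext fun Ψ => A.fields_ext ?_ ?_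
  · intro f
    exact key .antenna (fun g => A.ant g Ψ) f
  · intro s f
    exact key (.leg s) (fun g => A.leg s g Ψ) f

/-- The representation of the symmetry group on `L²(Γ)`: the generator `R` is the rotation by
`2π/3`, which maps every leg to the next one; the generator `F` is the reflection which fixes the
first leg and swaps the other two. -/
def symmetryRep : Representation ℂ (DihedralGroup 3) A.frame.L2 :=
  dihedralLift (A.act rotMatrix (Equiv.addRight 1)) (A.act reflMatrix (Equiv.neg _))
    (by
      rw [pow_three, act_act, act_act, ← pow_three, rotMatrix_cube, ← act_one]
      congr 1
      decide)
    (by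
      rw [pow_two, act_act, ← pow_two, reflMatrix_sq, ← act_one]
      congr 1
      decide)
    (by
      rw [act_act, act_act, act_act, refl_rot, ← act_one]
      congr 1
      decide)

/-- The labels of the four summands. -/
inductive Summand : Type
  | trv | alt | wob | wobBar

/-- The four subspaces `H_trv`, `H_alt`, `H_ω`, `H_ω̄`. -/
def summand : Summand → Submodule ℂ A.frame.L2
  | .trv => A.trv
  | .alt => A.alt
  | .wob => A.wob
  | .wobBar => A.wobBar

end AntennaTower

end

/-! Write `R` and `F` for the actions of `r 1` and `sr 0`. Two facts carry the proof: both operators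
are isometries of the state space (`inner_r`, `inner_sr`), and both map the graph of the Hamiltonian
into itself (`symmetryRep_r_mem_commutant`, `symmetryRep_sr_mem_commutant`). Self-adjointness of the
Hamiltonian is not used.

The rest of the operator theory is generic for the dihedral group. The projector onto the eigenvalue
ζ of `R` is ⅓ Σ ζ⁻ᵏ Rᵏ, and for ζ = 1 it is split by ½(1 ± F). These polynomials in `R` and `F` sum
to the identity and commute with the Hamiltonian, and their ranges are orthogonal because
eigenvectors of an isometry with different unimodular eigenvalues are. Such a resolution of the
identity reduces the operator (`isReducedBy_of_sum_eq`). The isotypic components come from writing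
down intertwiners on eigenvectors of `R` and `F`. Since F R = R⁻¹ F, the reflection exchanges the
eigenspaces for ω and ω̄ inside every ker(H − z), which gives the multiplicity two
(`rank_wob_inf_eq`). Conjugation would be less convenient here, as it leads from z to its conjugate.

The geometry enters in two places. First, `R` shifts the legs and rotates the pair (v, w) of the
antenna, while `F` reverses the sign of w and η and exchanges two legs (`leg_r`, `ant_r`, `leg_sr`,
`ant_sr`); solving the eigenvalue equations yields the four explicit subspaces (`summand_eq`).
Second, the joint conditions are vector equations, in which displacements and forces are polar
vectors and rotations and moments are axial ones, so they survive the symmetries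
(`jointConditions_rot`, `jointConditions_refl`). The rotation mixes v and w on the antenna, and this
is where its two bending stiffnesses have to be equal. -/

/-! ### Operators commuting with an unbounded operator -/

section Commutant

variable {F : Type*} [NormedAddCommGroup F] [InnerProductSpace ℂ F]

/-- The algebra of the everywhere defined operators which preserve the domain of `H` and commute
with `H`. -/
def commutant (H : F →ₗ.[ℂ] F) : Subalgebra ℂ (Module.End ℂ F) where
  carrier := {T | ∀ (x y : F), (x, y) ∈ H.graph → (T x, T y) ∈ H.graph}
  mul_mem' hS hT x y h := hS _ _ (hT x y h)
  add_mem' hS hT x y h := H.graph.add_mem (hS x y h) (hT x y h)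
  algebraMap_mem' r _ _ h := H.graph.smul_mem r h

/-- Passes from the graph form of commutation, which is convenient for algebra, to the form with an
explicit domain membership that occurs in `IsReducedBy`. -/
theorem exists_apply_eq_of_mem_commutant {H : F →ₗ.[ℂ] F} {T : Module.End ℂ F}
    (hT : T ∈ commutant H) (x : H.domain) :
    ∃ h : T (x : F) ∈ H.domain, H ⟨T (x : F), h⟩ = T (H x) := by
  obtain ⟨y, hy, e⟩ := (LinearPMap.mem_graph_iff H).mp (hT _ _ (H.mem_graph x))
  obtain ⟨y, hyd⟩ := y
  simp only at hy e
  subst hy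
  exact ⟨hyd, e⟩

theorem mem_unboundedEigenspace_iff {H : F →ₗ.[ℂ] F} {z : ℂ} {x : F} :
    x ∈ unboundedEigenspace H z ↔ (x, z • x) ∈ H.graph := by
  rw [LinearPMap.mem_graph_iff]
  constructor
  · rintro ⟨h, e⟩
    exact ⟨⟨x, h⟩, rfl, e⟩
  · rintro ⟨⟨y, hy⟩, e, e'⟩
    simp only at e e'
    subst e
    exact ⟨hy, e'⟩

theorem apply_mem_unboundedEigenspace {H : F →ₗ.[ℂ] F} {T : Module.End ℂ F}
    (hT : T ∈ commutant H) {z : ℂ} {x : F} (hx : x ∈ unboundedEigenspace H z) :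
    T x ∈ unboundedEigenspace H z := by
  rw [mem_unboundedEigenspace_iff] at hx ⊢
  rw [← map_smul]
  exact hT _ _ hx

/-- Mutually orthogonal subspaces which are the ranges of a resolution of the identity by operators
commuting with `H` form a reducing decomposition. -/
theorem isReducedBy_of_sum_eq {ι : Type*} [Fintype ι] {H : F →ₗ.[ℂ] F} {K : ι → Submodule ℂ F}
    {P : ι → Module.End ℂ F} (hmem : ∀ ρ x, P ρ x ∈ K ρ)
    (horth : ∀ ρ σ, ρ ≠ σ → ∀ x ∈ K ρ, ∀ y ∈ K σ, inner ℂ x y = 0)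
    (hsum : ∀ x, ∑ ρ, P ρ x = x) (hP : ∀ ρ, P ρ ∈ commutant H) : IsReducedBy H K := by
  classical
  -- The remainder is the sum of the other components, each orthogonal to `K ρ`. This identifies `P
  -- ρ` as the orthogonal projector without any completeness argument.
  have hcompl : ∀ ρ x, x - P ρ x ∈ (K ρ)ᗮ := by
    intro ρ x
    have : x - P ρ x = ∑ σ ∈ Finset.univ.erase ρ, P σ x := by
      rw [sub_eq_iff_eq_add, Finset.sum_erase_add _ _ (Finset.mem_univ ρ), hsum]
    rw [this]
    refine Submodule.sum_mem _ fun σ hσ => ?_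
    rw [Submodule.mem_orthogonal]
    intro y hy
    exact horth ρ σ (Finset.ne_of_mem_erase hσ).symm y hy _ (hmem σ x)
  have hproj : ∀ ρ, (K ρ).HasOrthogonalProjection := fun ρ =>
    ⟨fun x => ⟨P ρ x, hmem ρ x, hcompl ρ x⟩⟩
  have hstar : ∀ ρ x, (K ρ).starProjection x = P ρ x := fun ρ x =>
    Submodule.eq_starProjection_of_mem_orthogonal (hmem ρ x) (hcompl ρ x)
  have hfix : ∀ ρ, ∀ x ∈ K ρ, P ρ x = x := fun ρ x hx => by
    rw [← hstar, Submodule.starProjection_eq_self_iff.mpr hx]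
  refine ⟨hproj, ?_, ?_, ?_, ?_, ?_⟩
  · intro ρ σ hρσ x y
    exact horth ρ σ hρσ x x.2 y y.2
  · refine eq_top_iff.mpr fun x _ => ?_
    rw [← hsum x]
    exact Submodule.sum_mem _ fun ρ _ => Submodule.mem_iSup_of_mem ρ (hmem ρ x)
  · intro ρ x hx
    obtain ⟨h, e⟩ := exists_apply_eq_of_mem_commutant (hP ρ) x
    -- Since `P ρ` fixes x, commutation reads H x = `P ρ` (H x), and the right side lies in `K ρ`.
    have hx' : (⟨P ρ x, h⟩ : H.domain) = x := Subtype.ext (hfix ρ x hx)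
    rw [hx'] at e
    rw [e]
    exact hmem ρ _
  · refine le_antisymm (fun x hx => ?_) (iSup_le fun ρ => inf_le_right)
    rw [← hsum x]
    refine Submodule.sum_mem _ fun ρ _ => Submodule.mem_iSup_of_mem ρ ⟨hmem ρ x, ?_⟩
    exact (exists_apply_eq_of_mem_commutant (hP ρ) ⟨x, hx⟩).1
  · intro ρ x
    rw [hstar ρ (H x)]
    simp only [hstar ρ (x : F)]
    exact exists_apply_eq_of_mem_commutant (hP ρ) x

end Commutant

/-! ### Representations of the dihedral group of order six -/

noncomputable section Dihedral

open AntennaTower (omega Summand)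

theorem omega_eq :
    omega = Complex.ofReal (Real.cos (2 * Real.pi / 3)) +
      Real.sin (2 * Real.pi / 3) * Complex.I := by
  rw [omega, show 2 * (Real.pi : ℂ) * Complex.I / 3 = ((2 * Real.pi / 3 : ℝ) : ℂ) * Complex.I by
    push_cast; ring, Complex.exp_mul_I, Complex.ofReal_cos, Complex.ofReal_sin]

theorem star_omega_eq :
    star omega = Complex.ofReal (Real.cos (2 * Real.pi / 3)) -
      Real.sin (2 * Real.pi / 3) * Complex.I := by
  rw [omega_eq, star_add, StarMul.star_mul, Complex.star_def, Complex.conj_ofReal,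
    Complex.conj_ofReal, Complex.conj_I]
  ring

/-- With ω̄ eliminated in this way, identities between ω and ω̄ become polynomial identities modulo
`omega_sq_add`. -/
theorem star_omega : star omega = -1 - omega := by
  rw [star_omega_eq, omega_eq, cos_third]
  push_cast
  ring

theorem omega_sq_add : omega ^ 2 + omega + 1 = 0 := by
  have h : (Real.sin (2 * Real.pi / 3) : ℂ) * Real.sin (2 * Real.pi / 3) = 3 / 4 := by
    rw [← Complex.ofReal_mul, sin_third_sq]
    norm_num
  rw [omega_eq, cos_third]
  set s : ℂ := (Real.sin (2 * Real.pi / 3) : ℂ)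
  push_cast
  linear_combination (Complex.I ^ 2) * h + (3 / 4) * Complex.I_sq

theorem omega_ne_one : omega ≠ 1 := by
  intro h
  have := omega_sq_add
  rw [h] at this
  norm_num at this

theorem omega_ne_neg_one_sub : omega ≠ -1 - omega := by
  intro h
  have h2 : omega = -1 / 2 := by linear_combination h / 2
  have := omega_sq_add
  rw [h2] at this
  norm_num at this

/-- Built from an explicit list so that sums over the labels unfold by `rfl`; the fold over the list
leaves the trailing `+ 0` in `sum_summand`. -/
instance : Fintype Summand :=
  ⟨⟨([.trv, .alt, .wob, .wobBar] : List Summand), by simp⟩, fun x => by cases x <;> simp⟩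

theorem sum_summand {X : Type*} [AddCommMonoid X] (g : Summand → X) :
    ∑ ρ, g ρ = g .trv + (g .alt + (g .wob + (g .wobBar + 0))) := by
  rfl

theorem r_eq_pow (i : ZMod 3) :
    DihedralGroup.r i = (DihedralGroup.r 1 : DihedralGroup 3) ^ i.val := by
  revert i; decide

theorem sr_eq_mul (i : ZMod 3) :
    DihedralGroup.sr i = DihedralGroup.sr 0 * (DihedralGroup.r 1 : DihedralGroup 3) ^ i.val := by
  revert i; decide

/-- A submonoid of the dihedral group which contains the two generators is everything. -/
theorem dihedral_submonoid_eq_top (S : Submonoid (DihedralGroup 3)) (hr : .r 1 ∈ S)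
    (hs : .sr 0 ∈ S) (g : DihedralGroup 3) : g ∈ S := by
  rcases g with i | i
  · rw [r_eq_pow]
    exact S.pow_mem hr _
  · rw [sr_eq_mul]
    exact S.mul_mem hs (S.pow_mem hr _)

/-! ### Projectors and isotypic components of a representation of the dihedral group. -/

section Algebraic

variable {V W : Type*} [AddCommGroup V] [Module ℂ V] [AddCommGroup W] [Module ℂ W]
  (π : Representation ℂ (DihedralGroup 3) V)

theorem rep_r_cube (x : V) : π (.r 1) (π (.r 1) (π (.r 1) x)) = x := by
  rw [← Module.End.mul_apply, ← Module.End.mul_apply, ← map_mul, ← map_mul,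
    show (.r 1 * .r 1 * .r 1 : DihedralGroup 3) = 1 by decide, map_one, Module.End.one_apply]

theorem rep_sr_sr (x : V) : π (.sr 0) (π (.sr 0) x) = x := by
  rw [← Module.End.mul_apply, ← map_mul, show (.sr 0 * .sr 0 : DihedralGroup 3) = 1 by decide,
    map_one, Module.End.one_apply]

/-- Oriented so that the reflection moves inward. Together with `rep_r_cube` and `rep_sr_sr` it
brings words in the generators applied to x to the normal form Rⁱ Fʲ x, after which only linear
algebra in the coefficients remains. -/
theorem rep_sr_r (x : V) : π (.sr 0) (π (.r 1) x) = π (.r 1) (π (.r 1) (π (.sr 0) x)) := by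
  rw [← Module.End.mul_apply, ← Module.End.mul_apply, ← Module.End.mul_apply, ← map_mul, ← map_mul,
    ← map_mul, show (.sr 0 * .r 1 : DihedralGroup 3) = .r 1 * .r 1 * .sr 0 by decide]

/-- A linear map which commutes with the two generators is an intertwiner. -/
def intertwiningOfGenerators (ρ : Representation ℂ (DihedralGroup 3) W) (f : W →ₗ[ℂ] V)
    (hr : ∀ x, f (ρ (.r 1) x) = π (.r 1) (f x)) (hs : ∀ x, f (ρ (.sr 0) x) = π (.sr 0) (f x)) :
    ρ.IntertwiningMap π where
  toLinearMap := f
  isIntertwining' g := by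
    let S : Submonoid (DihedralGroup 3) :=
      { carrier := {g | ∀ x, f (ρ g x) = π g (f x)}
        one_mem' := by simp
        mul_mem' := fun {a b} ha hb x => by simp [ha _, hb _] }
    exact LinearMap.ext (dihedral_submonoid_eq_top S hr hs g)

theorem mem_isotypicPart {ρ : Representation ℂ (DihedralGroup 3) W} (φ : ρ.IntertwiningMap π)
    (x : W) : φ.toLinearMap x ∈ isotypicPart ρ π :=
  Submodule.mem_iSup_of_mem φ ⟨x, rfl⟩

theorem isotypicPart_le {ρ : Representation ℂ (DihedralGroup 3) W} {K : Submodule ℂ V}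
    (h : ∀ f : W →ₗ[ℂ] V, (∀ g x, f (ρ g x) = π g (f x)) → ∀ x, f x ∈ K) :
    isotypicPart ρ π ≤ K := by
  refine iSup_le fun φ => ?_
  rintro _ ⟨x, rfl⟩
  exact h _ (fun g => LinearMap.congr_fun (φ.isIntertwining' g)) x

/-- The subspaces on which the generator `R` acts by a character of the subgroup of rotations,
those with trivial character being split by the generator `F`. -/
def dihedralSummand : Summand → Submodule ℂ V
  | .trv => Module.End.eigenspace (π (.r 1)) 1 ⊓ Module.End.eigenspace (π (.sr 0)) 1
  | .alt => Module.End.eigenspace (π (.r 1)) 1 ⊓ Module.End.eigenspace (π (.sr 0)) (-1)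
  | .wob => Module.End.eigenspace (π (.r 1)) (star omega)
  | .wobBar => Module.End.eigenspace (π (.r 1)) omega

/-- The projections onto the spaces `dihedralSummand`. -/
def dihedralProj : Summand → Module.End ℂ V
  | .trv => (1 / 6 : ℂ) • ((1 + π (.r 1) + π (.r 1) * π (.r 1)) * (1 + π (.sr 0)))
  | .alt => (1 / 6 : ℂ) • ((1 + π (.r 1) + π (.r 1) * π (.r 1)) * (1 + (-1 : ℂ) • π (.sr 0)))
  -- The coefficients are ζ⁻ᵏ for the eigenvalue ζ = ω̄, so ζ⁻¹ = ω and ζ⁻² = ω² = −1 − ω. The next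
  -- case has ω and ω̄ interchanged.
  | .wob => (1 / 3 : ℂ) • (1 + omega • π (.r 1) + (-1 - omega) • (π (.r 1) * π (.r 1)))
  | .wobBar => (1 / 3 : ℂ) • (1 + (-1 - omega) • π (.r 1) + omega • (π (.r 1) * π (.r 1)))

/-- The projectors are polynomials in the two generators. Taking `S` to be `commutant H` shows that
they commute with H and preserve its eigenspaces. -/
theorem dihedralProj_mem_of_generators {S : Subalgebra ℂ (Module.End ℂ V)} (hr : π (.r 1) ∈ S)
    (hs : π (.sr 0) ∈ S) (ρ : Summand) : dihedralProj π ρ ∈ S := by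
  cases ρ <;> refine S.smul_mem ?_ _
  · exact S.mul_mem (S.add_mem (S.add_mem S.one_mem hr) (S.mul_mem hr hr)) (S.add_mem S.one_mem hs)
  · exact S.mul_mem (S.add_mem (S.add_mem S.one_mem hr) (S.mul_mem hr hr))
      (S.add_mem S.one_mem (S.smul_mem hs _))
  · exact S.add_mem (S.add_mem S.one_mem (S.smul_mem hr _)) (S.smul_mem (S.mul_mem hr hr) _)
  · exact S.add_mem (S.add_mem S.one_mem (S.smul_mem hr _)) (S.smul_mem (S.mul_mem hr hr) _)

theorem dihedralProj_mem (ρ : Summand) (x : V) : dihedralProj π ρ x ∈ dihedralSummand π ρ := by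
  have hω := omega_sq_add
  cases ρ
  · refine ⟨Module.End.mem_eigenspace_iff.mpr ?_, Module.End.mem_eigenspace_iff.mpr ?_⟩ <;>
      simp only [dihedralProj, LinearMap.smul_apply, Module.End.mul_apply, LinearMap.add_apply,
        Module.End.one_apply, map_add, map_smul, rep_r_cube, rep_sr_r, rep_sr_sr] <;> module
  · refine ⟨Module.End.mem_eigenspace_iff.mpr ?_, Module.End.mem_eigenspace_iff.mpr ?_⟩ <;>
      simp only [dihedralProj, LinearMap.smul_apply, Module.End.mul_apply, LinearMap.add_apply,
        Module.End.one_apply, map_add, map_smul, rep_r_cube, rep_sr_r, rep_sr_sr] <;> module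
  · refine Module.End.mem_eigenspace_iff.mpr ?_
    simp only [dihedralProj, LinearMap.smul_apply, Module.End.mul_apply, LinearMap.add_apply,
      Module.End.one_apply, map_add, map_smul, rep_r_cube, star_omega]
    -- After the cyclic shift by R³ = 1 the coefficients of x agree, and those of R x and R² x
    -- differ by ±(ω² + ω + 1)/3.
    linear_combination (norm := module) (1 / 3 * hω) • (π (.r 1) x) -
      (1 / 3 * hω) • (π (.r 1) (π (.r 1) x))
  · refine Module.End.mem_eigenspace_iff.mpr ?_
    simp only [dihedralProj, LinearMap.smul_apply, Module.End.mul_apply, LinearMap.add_apply,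
      Module.End.one_apply, map_add, map_smul, rep_r_cube]
    linear_combination (norm := module) (1 / 3 * hω) • (π (.r 1) x) -
      (1 / 3 * hω) • (π (.r 1) (π (.r 1) x))

/-- The reflection cancels between the first two projectors, and the coefficients 1, ω, −1 − ω of R,
and likewise of R², add up to zero. -/
theorem sum_dihedralProj (x : V) : ∑ ρ, dihedralProj π ρ x = x := by
  simp only [sum_summand, dihedralProj, LinearMap.smul_apply, Module.End.mul_apply,
    LinearMap.add_apply, Module.End.one_apply, map_add, map_smul]
  module

/-- From F R = R⁻¹ F: the reflection turns an eigenvalue of R into its inverse. -/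
theorem rep_sr_mem_eigenspace {l m : ℂ} (h : l * m = 1) {x : V}
    (hx : x ∈ Module.End.eigenspace (π (.r 1)) m) :
    π (.sr 0) x ∈ Module.End.eigenspace (π (.r 1)) l := by
  refine Module.End.mem_eigenspace_iff.mpr ?_
  have h1 : π (.r 1) (π (.sr 0) (π (.r 1) x)) = π (.sr 0) x := by
    rw [rep_sr_r, rep_r_cube]
  rw [Module.End.mem_eigenspace_iff.mp hx, map_smul, map_smul] at h1
  calc π (.r 1) (π (.sr 0) x) = l • m • π (.r 1) (π (.sr 0) x) := by rw [smul_smul, h, one_smul]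
    _ = _ := by rw [h1]

theorem omega_mul_star : omega * star omega = 1 := by
  rw [star_omega]
  linear_combination -omega_sq_add

theorem rep_sr_mem_wobBar {x : V} (hx : x ∈ dihedralSummand π .wob) :
    π (.sr 0) x ∈ dihedralSummand π .wobBar :=
  rep_sr_mem_eigenspace π omega_mul_star hx

theorem rep_sr_mem_wob {x : V} (hx : x ∈ dihedralSummand π .wobBar) :
    π (.sr 0) x ∈ dihedralSummand π .wob :=
  rep_sr_mem_eigenspace π ((mul_comm _ _).trans omega_mul_star) hx

/-- An intertwiner from a one-dimensional representation is determined by the image of 1, which can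
be any joint eigenvector of the generators with the prescribed eigenvalues. The alternating case
below is the same. -/
theorem dihedralSummand_trv_eq_isotypicPart :
    dihedralSummand π .trv =
      isotypicPart (Representation.trivial ℂ (DihedralGroup 3) ℂ) π := by
  refine le_antisymm (fun x hx => ?_) (isotypicPart_le π fun f hf c => ⟨?_, ?_⟩)
  · have h1 : π (.r 1) x = (1 : ℂ) • x := Module.End.mem_eigenspace_iff.mp hx.1
    have h2 : π (.sr 0) x = (1 : ℂ) • x := Module.End.mem_eigenspace_iff.mp hx.2
    have := mem_isotypicPart π (intertwiningOfGenerators π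
      (Representation.trivial ℂ (DihedralGroup 3) ℂ) (LinearMap.toSpanSingleton ℂ V x)
      (fun c => by simp [h1]) (fun c => by simp [h2])) 1
    simpa [intertwiningOfGenerators] using this
  · exact Module.End.mem_eigenspace_iff.mpr (by rw [← hf]; simp)
  · exact Module.End.mem_eigenspace_iff.mpr (by rw [← hf]; simp)

theorem altRep_r (c : ℂ) : altRep (.r 1) c = c := by
  change ((1 : Module.End ℂ ℂ) ^ (1 : ZMod 3).val) c = c
  simp

theorem altRep_sr (c : ℂ) : altRep (.sr 0) c = -c := by
  change ((-1 : Module.End ℂ ℂ) * (1 : Module.End ℂ ℂ) ^ (0 : ZMod 3).val) c = -c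
  simp

theorem dihedralSummand_alt_eq_isotypicPart :
    dihedralSummand π .alt = isotypicPart altRep π := by
  refine le_antisymm (fun x hx => ?_) (isotypicPart_le π fun f hf c => ⟨?_, ?_⟩)
  · have h1 : π (.r 1) x = (1 : ℂ) • x := Module.End.mem_eigenspace_iff.mp hx.1
    have h2 : π (.sr 0) x = (-1 : ℂ) • x := Module.End.mem_eigenspace_iff.mp hx.2
    have := mem_isotypicPart π (intertwiningOfGenerators π altRep
      (LinearMap.toSpanSingleton ℂ V x)
      (fun c => by simp [h1, altRep_r]) (fun c => by simp [h2, altRep_sr])) 1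
    simpa [intertwiningOfGenerators] using this
  · exact Module.End.mem_eigenspace_iff.mpr (by rw [← hf, altRep_r]; simp)
  · exact Module.End.mem_eigenspace_iff.mpr (by rw [← hf, altRep_sr]; simp)

theorem stdRep_r (p : Fin 2 → ℂ) : stdRep (.r 1) p =
    ![Real.cos (2 * Real.pi / 3) * p 0 - Real.sin (2 * Real.pi / 3) * p 1,
      Real.sin (2 * Real.pi / 3) * p 0 + Real.cos (2 * Real.pi / 3) * p 1] := by
  change ((Matrix.toLinAlgEquiv' (horizontalBlock rotMatrix)) ^ (1 : ZMod 3).val) p = _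
  rw [show (1 : ZMod 3).val = 1 from rfl, pow_one, Matrix.toLinAlgEquiv'_apply]
  ext n
  fin_cases n <;>
    simp [horizontalBlock, rotMatrix, Matrix.mulVec, dotProduct, Fin.sum_univ_two, sub_eq_add_neg]

theorem stdRep_sr (p : Fin 2 → ℂ) : stdRep (.sr 0) p = ![p 0, - p 1] := by
  change ((Matrix.toLinAlgEquiv' (horizontalBlock reflMatrix)) *
    (Matrix.toLinAlgEquiv' (horizontalBlock rotMatrix)) ^ (0 : ZMod 3).val) p = _
  rw [show (0 : ZMod 3).val = 0 from rfl, pow_zero, mul_one, Matrix.toLinAlgEquiv'_apply]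
  ext n
  fin_cases n <;>
    simp [horizontalBlock, reflMatrix, Matrix.mulVec, dotProduct, Fin.sum_univ_two]

/-- The vectors `(1, i)` and `(1, -i)` of the standard representation are sent to `x` and `y`. -/
def stdMap (x y : V) : (Fin 2 → ℂ) →ₗ[ℂ] V where
  toFun p := ((p 0 - Complex.I * p 1) / 2) • x + ((p 0 + Complex.I * p 1) / 2) • y
  map_add' p q := by simp only [Pi.add_apply]; module
  map_smul' r p := by simp only [Pi.smul_apply, smul_eq_mul, RingHom.id_apply]; module

/-- On ℂ² the vectors (1, i) and (1, −i) are eigenvectors of R with eigenvalues ω̄ and ω and are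
exchanged by F. The vectors x and F x obey the same relations, so `stdMap x (F x)` is equivariant.
-/
theorem mem_isotypicPart_stdRep {x : V} (hx : x ∈ dihedralSummand π .wob) (p : Fin 2 → ℂ) :
    stdMap x (π (.sr 0) x) p ∈ isotypicPart stdRep π := by
  have h1 : π (.r 1) x = star omega • x := Module.End.mem_eigenspace_iff.mp hx
  have h2 : π (.r 1) (π (.sr 0) x) = omega • π (.sr 0) x :=
    Module.End.mem_eigenspace_iff.mp (rep_sr_mem_wobBar π hx)
  refine mem_isotypicPart π (intertwiningOfGenerators π stdRep (stdMap x (π (.sr 0) x))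
    (fun q => ?_) (fun q => ?_)) p
  · simp only [stdMap, LinearMap.coe_mk, AddHom.coe_mk, map_add, map_smul, h1, h2, stdRep_r, Matrix.cons_val_zero, Matrix.cons_val_one]
    rw [star_omega_eq, omega_eq]
    have hI := Complex.I_sq
    linear_combination (norm := module)
      (-(1 / 2) * (Real.sin (2 * Real.pi / 3) : ℂ) * q 1 * hI) • x -
      ((1 / 2) * (Real.sin (2 * Real.pi / 3) : ℂ) * q 1 * hI) • π (.sr 0) x
  · simp only [stdMap, LinearMap.coe_mk, AddHom.coe_mk, map_add, map_smul, stdRep_sr, rep_sr_sr,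
      Matrix.cons_val_zero, Matrix.cons_val_one]
    module

theorem sup_eq_isotypicPart_stdRep :
    dihedralSummand π .wob ⊔ dihedralSummand π .wobBar = isotypicPart stdRep π := by
  refine le_antisymm (sup_le (fun x hx => ?_) (fun x hx => ?_)) (isotypicPart_le π fun f hf p => ?_)
  · have := mem_isotypicPart_stdRep π hx ![1, Complex.I]
    simpa [stdMap] using this
  · have := mem_isotypicPart_stdRep π (rep_sr_mem_wob π hx) ![1, -Complex.I]
    simpa [stdMap, rep_sr_sr] using this
  · have hp : p = ((p 0 - Complex.I * p 1) / 2) • ![1, Complex.I] +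
        ((p 0 + Complex.I * p 1) / 2) • ![1, -Complex.I] := by
      ext n
      fin_cases n
      · simp; ring
      · simp; linear_combination (p 1) * Complex.I_sq
    have e1 : stdRep (.r 1) ![1, Complex.I] = star omega • ![1, Complex.I] := by
      rw [stdRep_r, star_omega_eq]
      set s : ℂ := (Real.sin (2 * Real.pi / 3) : ℂ)
      set c : ℂ := (Real.cos (2 * Real.pi / 3) : ℂ)
      ext n
      fin_cases n
      · simp
      · simp; linear_combination s * Complex.I_sq
    have e2 : stdRep (.r 1) ![1, -Complex.I] = omega • ![1, -Complex.I] := by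
      rw [stdRep_r, omega_eq]
      set s : ℂ := (Real.sin (2 * Real.pi / 3) : ℂ)
      set c : ℂ := (Real.cos (2 * Real.pi / 3) : ℂ)
      ext n
      fin_cases n
      · simp
      · simp; linear_combination s * Complex.I_sq
    rw [hp, map_add, map_smul, map_smul]
    refine Submodule.add_mem_sup (Submodule.smul_mem _ _ ?_) (Submodule.smul_mem _ _ ?_)
    · exact Module.End.mem_eigenspace_iff.mpr (by rw [← hf, e1, map_smul])
    · exact Module.End.mem_eigenspace_iff.mpr (by rw [← hf, e2, map_smul])

end Algebraic

/-! ### Orthogonality and multiplicities for an isometric action. -/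

section Unitary

variable {V : Type*} [NormedAddCommGroup V] [InnerProductSpace ℂ V]
  {π : Representation ℂ (DihedralGroup 3) V}

/-- ⟨x, y⟩ = ⟨T x, T y⟩ = l̄ m ⟨x, y⟩. -/
theorem inner_eq_zero_of_isometry {T : Module.End ℂ V}
    (hT : ∀ x y, inner ℂ (T x) (T y) = inner ℂ x y)
    {l m : ℂ} (hlm : star l * m ≠ 1) {x y : V} (hx : x ∈ Module.End.eigenspace T l)
    (hy : y ∈ Module.End.eigenspace T m) : inner ℂ x y = 0 := by
  have h := hT x y
  rw [Module.End.mem_eigenspace_iff.mp hx, Module.End.mem_eigenspace_iff.mp hy, inner_smul_left,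
    inner_smul_right, ← mul_assoc] at h
  have h2 : (star l * m - 1) * inner ℂ x y = 0 := by
    rw [sub_mul, one_mul, sub_eq_zero]; exact h
  exact (mul_eq_zero.mp h2).resolve_left (sub_ne_zero.mpr hlm)

/-- The reflection separates `trv` from `alt`; the rotation separates every other pair, as ω, ω̄ and
their squares are different from 1. -/
theorem dihedralSummand_orthogonal
    (hr : ∀ x y, inner ℂ (π (.r 1) x) (π (.r 1) y) = inner ℂ x y)
    (hs : ∀ x y, inner ℂ (π (.sr 0) x) (π (.sr 0) y) = inner ℂ x y)
    (ρ σ : Summand) (hρσ : ρ ≠ σ) (x : V) (hx : x ∈ dihedralSummand π ρ) (y : V)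
    (hy : y ∈ dihedralSummand π σ) : inner ℂ x y = 0 := by
  have hω := omega_sq_add
  have h1 := omega_ne_one
  have h2 := omega_ne_neg_one_sub
  have h3 : -1 - omega ≠ 1 := fun h => by
    have h4 : omega = -2 := by linear_combination -h
    rw [h4] at hω
    norm_num at hω
  have h5 : star (star omega) * star (star omega) ≠ 1 := by
    rw [star_star]
    intro h
    exact h3 (by linear_combination h - hω)
  have h7 : star omega * star omega ≠ 1 := by
    rw [star_omega]
    intro h
    exact h1 (by linear_combination h - hω)
  rw [star_star] at h5
  cases ρ <;> cases σ <;> first | exact absurd rfl hρσ | skip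
  · exact inner_eq_zero_of_isometry hs (by norm_num) hx.2 hy.2
  · exact inner_eq_zero_of_isometry hr (by rwa [star_one, one_mul, star_omega]) hx.1 hy
  · exact inner_eq_zero_of_isometry hr (by rwa [star_one, one_mul]) hx.1 hy
  · exact inner_eq_zero_of_isometry hs (by norm_num) hx.2 hy.2
  · exact inner_eq_zero_of_isometry hr (by rwa [star_one, one_mul, star_omega]) hx.1 hy
  · exact inner_eq_zero_of_isometry hr (by rwa [star_one, one_mul]) hx.1 hy
  · exact inner_eq_zero_of_isometry hr (by rwa [star_star, mul_one]) hx hy.1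
  · exact inner_eq_zero_of_isometry hr (by rwa [star_star, mul_one]) hx hy.1
  · exact inner_eq_zero_of_isometry hr (by rwa [star_star]) hx hy
  · exact inner_eq_zero_of_isometry hr (by rwa [mul_one, star_omega]) hx hy.1
  · exact inner_eq_zero_of_isometry hr (by rwa [mul_one, star_omega]) hx hy.1
  · exact inner_eq_zero_of_isometry hr h7 hx hy

variable {H : V →ₗ.[ℂ] V}

theorem rep_mem_commutant (hr : π (.r 1) ∈ commutant H) (hs : π (.sr 0) ∈ commutant H)
    (g : DihedralGroup 3) : π g ∈ commutant H :=
  dihedral_submonoid_eq_top ((commutant H).toSubmonoid.comap π) hr hs g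

theorem isReducedBy_dihedralSummand
    (hr : ∀ x y, inner ℂ (π (.r 1) x) (π (.r 1) y) = inner ℂ x y)
    (hs : ∀ x y, inner ℂ (π (.sr 0) x) (π (.sr 0) y) = inner ℂ x y)
    (hHr : π (.r 1) ∈ commutant H) (hHs : π (.sr 0) ∈ commutant H) :
    IsReducedBy H (dihedralSummand π) :=
  isReducedBy_of_sum_eq (dihedralProj_mem π) (dihedralSummand_orthogonal hr hs)
    (sum_dihedralProj π) (dihedralProj_mem_of_generators π hHr hHs)

/-- The involution F is linear, commutes with H and exchanges the two eigenspaces of R, so it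
restricts to an isomorphism for every complex z. -/
theorem rank_wob_inf_eq (hHs : π (.sr 0) ∈ commutant H) (z : ℂ) :
    Module.rank ℂ ↥(dihedralSummand π .wob ⊓ unboundedEigenspace H z) =
      Module.rank ℂ ↥(dihedralSummand π .wobBar ⊓ unboundedEigenspace H z) :=
  LinearEquiv.rank_eq <| LinearEquiv.ofLinearMap
    ((π (.sr 0)).restrict fun _ hx =>
      ⟨rep_sr_mem_wobBar π hx.1, apply_mem_unboundedEigenspace hHs hx.2⟩)
    ((π (.sr 0)).restrict fun _ hx =>
      ⟨rep_sr_mem_wob π hx.1, apply_mem_unboundedEigenspace hHs hx.2⟩)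
    (LinearMap.ext fun x => Subtype.ext (rep_sr_sr π x))
    (LinearMap.ext fun x => Subtype.ext (rep_sr_sr π x))

/-- The dimension of a subspace which is invariant under the projections of an orthogonal
decomposition is the sum of the dimensions of its intersections with the summands. -/
theorem rank_eq_add_of_orthogonal {K : Summand → Submodule ℂ V} {P : Summand → Module.End ℂ V}
    (hmem : ∀ ρ x, P ρ x ∈ K ρ)
    (horth : ∀ ρ σ, ρ ≠ σ → ∀ x ∈ K ρ, ∀ y ∈ K σ, inner ℂ x y = 0)
    (hsum : ∀ x, ∑ ρ, P ρ x = x) (E : Submodule ℂ V) (hE : ∀ ρ, ∀ x ∈ E, P ρ x ∈ E) :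
    Module.rank ℂ E = Module.rank ℂ ↥(K .trv ⊓ E) + Module.rank ℂ ↥(K .alt ⊓ E) +
      (Module.rank ℂ ↥(K .wob ⊓ E) + Module.rank ℂ ↥(K .wobBar ⊓ E)) := by
  have hrank : ∀ A B : Submodule ℂ V, (∀ x ∈ A, ∀ y ∈ B, inner ℂ x y = 0) →
      Module.rank ℂ ↥(A ⊔ B) = Module.rank ℂ A + Module.rank ℂ B := by
    intro A B h
    have : A ⊓ B = ⊥ := by
      refine (Submodule.eq_bot_iff _).mpr fun x hx => ?_
      exact inner_self_eq_zero.mp (h x hx.1 x hx.2)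
    rw [← Submodule.rank_sup_add_rank_inf_eq, this, rank_bot, add_zero]
  -- Invariance of E under the projectors is what makes E the sum of its intersections with the
  -- summands.
  have hE' : E = (K .trv ⊓ E ⊔ K .alt ⊓ E) ⊔ (K .wob ⊓ E ⊔ K .wobBar ⊓ E) := by
    refine le_antisymm (fun x hx => ?_)
      (sup_le (sup_le inf_le_right inf_le_right) (sup_le inf_le_right inf_le_right))
    have h := hsum x
    rw [sum_summand, add_zero, ← add_assoc] at h
    rw [← h]
    have hP : ∀ ρ, P ρ x ∈ K ρ ⊓ E := fun ρ => ⟨hmem ρ x, hE ρ x hx⟩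
    exact Submodule.add_mem_sup (Submodule.add_mem_sup (hP _) (hP _))
      (Submodule.add_mem_sup (hP _) (hP _))
  have ho : ∀ ρ σ, ρ ≠ σ → ∀ x ∈ K ρ ⊓ E, ∀ y ∈ K σ ⊓ E, inner ℂ x y = 0 :=
    fun ρ σ h x hx y hy => horth ρ σ h x hx.1 y hy.1
  conv_lhs => rw [hE']
  rw [hrank, hrank, hrank]
  · exact ho _ _ (by simp)
  · exact ho _ _ (by simp)
  · intro x hx y hy
    obtain ⟨x1, hx1, x2, hx2, rfl⟩ := Submodule.mem_sup.mp hx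
    obtain ⟨y1, hy1, y2, hy2, rfl⟩ := Submodule.mem_sup.mp hy
    rw [inner_add_left, inner_add_right, inner_add_right, ho _ _ (by simp) x1 hx1 y1 hy1,
      ho _ _ (by simp) x1 hx1 y2 hy2, ho _ _ (by simp) x2 hx2 y1 hy1,
      ho _ _ (by simp) x2 hx2 y2 hy2]
    simp

theorem rank_unboundedEigenspace_eq
    (hr : ∀ x y, inner ℂ (π (.r 1) x) (π (.r 1) y) = inner ℂ x y)
    (hs : ∀ x y, inner ℂ (π (.sr 0) x) (π (.sr 0) y) = inner ℂ x y)
    (hHr : π (.r 1) ∈ commutant H) (hHs : π (.sr 0) ∈ commutant H) (z : ℂ) :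
    Module.rank ℂ ↥(unboundedEigenspace H z) =
      Module.rank ℂ ↥(dihedralSummand π .trv ⊓ unboundedEigenspace H z) +
      Module.rank ℂ ↥(dihedralSummand π .alt ⊓ unboundedEigenspace H z) +
      2 * Module.rank ℂ ↥(dihedralSummand π .wob ⊓ unboundedEigenspace H z) := by
  rw [rank_eq_add_of_orthogonal (dihedralProj_mem π) (dihedralSummand_orthogonal hr hs)
    (sum_dihedralProj π) _ fun ρ _ =>
      apply_mem_unboundedEigenspace (dihedralProj_mem_of_generators π hHr hHs ρ),
    ← rank_wob_inf_eq hHs, two_mul]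

end Unitary

end Dihedral

noncomputable section

namespace AntennaTower

variable (A : AntennaTower)

/-- The sign by which the reflection acts on a field of a beam in a reflection plane. -/
def reflSign : BeamField → ℝ
  | .v => 1
  | .w => -1
  | .u => 1
  | .η => -1

/-! ### The action of the generators -/

/-- If T carries the local basis of e to that of e' up to factors ε, orthonormality makes the field
matrix diagonal. The vector attached to η is zero, so `h` says nothing about ε η, which is fixed by
the determinant instead. -/
theorem sum_fieldMatrix_smul {l : ℝ} (T : Matrix (Fin 3) (Fin 3) ℝ) (e' e : TowerEdge)
    (ε : BeamField → ℝ) (hη : ε .η = T.det)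
    (h : ∀ f, T *ᵥ A.frame.dir e f = ε f • A.frame.dir e' f) (X : BeamField → EdgeL2 l)
    (f : BeamField) :
    ∑ f', (A.fieldMatrix T e' e f f' : ℂ) • X f' = (ε f : ℂ) • X f := by
  have hd : ∀ f', A.fieldMatrix T e' e f f' = ε f' * (1 : Matrix BeamField BeamField ℝ) f f' := by
    intro f'
    have e1 : (A.dirMatrix e' * T * (A.dirMatrix e)ᵀ) f f' =
        A.frame.dir e' f ⬝ᵥ (T *ᵥ A.frame.dir e f') := by
      rw [Matrix.mul_assoc]; rfl
    have e2 : (1 : Matrix BeamField BeamField ℝ) f f' = A.frame.dir e' f ⬝ᵥ A.frame.dir e' f' +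
        (Matrix.single BeamField.η BeamField.η (1 : ℝ)) f f' :=
      (congrFun (congrFun (A.dirMatrix_mul_transpose e') f) f').symm
    have e3 : A.fieldMatrix T e' e f f' = A.frame.dir e' f ⬝ᵥ (T *ᵥ A.frame.dir e f') +
        T.det * (Matrix.single BeamField.η BeamField.η (1 : ℝ)) f f' := by
      rw [← e1]; rfl
    rw [e3, h, e2, dotProduct_smul, ← hη, smul_eq_mul, mul_add]
    congr 1
    -- The matrix unit is supported at f' = η, where ε f' and ε η are the same.
    cases f' <;> simp
  rw [Finset.sum_eq_single f]
  · rw [hd, Matrix.one_apply_eq, mul_one]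
  · intro g _ hg
    rw [hd, Matrix.one_apply_ne hg.symm]
    simp
  · simp

theorem rotMatrix_det : rotMatrix.det = 1 := by
  have h := sin_third_sq
  rw [rotMatrix, Matrix.det_fin_three, cos_third]
  simp
  linarith

theorem reflMatrix_det : reflMatrix.det = -1 := by
  rw [reflMatrix, Matrix.det_fin_three]
  simp

theorem zmod_three_cases (s : ZMod 3) : s = 0 ∨ s = 1 ∨ s = 2 := by
  revert s; decide

/-- For s = 0 the exponent on the right wraps around to 2, and the cube relation closes the cycle.
-/
theorem rotMatrix_pow_val (s : ZMod 3) :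
    rotMatrix ^ s.val = rotMatrix * rotMatrix ^ (s - 1).val := by
  obtain rfl | rfl | rfl := zmod_three_cases s
  · change rotMatrix ^ 0 = rotMatrix * rotMatrix ^ 2
    rw [← pow_succ', rotMatrix_cube, pow_zero]
  · change rotMatrix ^ 1 = rotMatrix * rotMatrix ^ 0
    simp
  · change rotMatrix ^ 2 = rotMatrix * rotMatrix ^ 1
    simp [sq]

/-- Moves the reflection past the rotation that defines a leg, so that it acts on the basis of the
first leg, where its signs are visible. -/
theorem reflMatrix_mul_pow (s : ZMod 3) :
    reflMatrix * rotMatrix ^ (-s).val = rotMatrix ^ s.val * reflMatrix := by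
  have h2 : rotMatrix * reflMatrix = reflMatrix * rotMatrix ^ 2 := by
    calc rotMatrix * reflMatrix
        = reflMatrix ^ 2 * (rotMatrix * reflMatrix) * rotMatrix ^ 3 := by
          rw [reflMatrix_sq, rotMatrix_cube, one_mul, mul_one]
      _ = reflMatrix * (reflMatrix * rotMatrix * reflMatrix * rotMatrix) * rotMatrix ^ 2 := by
          simp only [pow_succ, pow_zero, one_mul, mul_assoc]
      _ = reflMatrix * rotMatrix ^ 2 := by rw [refl_rot, mul_one]
  obtain rfl | rfl | rfl := zmod_three_cases s
  · change reflMatrix * rotMatrix ^ 0 = rotMatrix ^ 0 * reflMatrix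
    simp
  · change reflMatrix * rotMatrix ^ 2 = rotMatrix ^ 1 * reflMatrix
    rw [pow_one, h2]
  · change reflMatrix * rotMatrix ^ 1 = rotMatrix ^ 2 * reflMatrix
    rw [sq, mul_assoc, h2, ← mul_assoc, h2, mul_assoc, ← pow_add,
      show 2 + 2 = 3 + 1 from rfl, pow_add, rotMatrix_cube, one_mul]

theorem rotMatrix_dir_leg (s : ZMod 3) (f : BeamField) :
    rotMatrix *ᵥ A.frame.dir (.leg (s - 1)) f = A.frame.dir (.leg s) f := by
  cases f <;> simp [BeamFrame.dir, frame, axial, principal₁, principal₂, rotMatrix_pow_val s]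

theorem reflMatrix_dir_leg (s : ZMod 3) (f : BeamField) :
    reflMatrix *ᵥ A.frame.dir (.leg (-s)) f = reflSign f • A.frame.dir (.leg s) f := by
  have h : ∀ x : Fin 3 → ℝ, reflMatrix *ᵥ (rotMatrix ^ (-s).val *ᵥ x) =
      rotMatrix ^ s.val *ᵥ (reflMatrix *ᵥ x) := fun x => by
    rw [Matrix.mulVec_mulVec, Matrix.mulVec_mulVec, reflMatrix_mul_pow]
  cases f
  · change reflMatrix *ᵥ (rotMatrix ^ (-s).val *ᵥ _) = _ • (rotMatrix ^ s.val *ᵥ _)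
    rw [h, ← Matrix.mulVec_smul]
    congr 1
    ext n
    fin_cases n <;> simp [reflMatrix, reflSign]
  · change reflMatrix *ᵥ (rotMatrix ^ (-s).val *ᵥ _) = _ • (rotMatrix ^ s.val *ᵥ _)
    rw [h, ← Matrix.mulVec_smul]
    congr 1
    ext n
    fin_cases n <;> simp [reflMatrix, reflSign]
  · change reflMatrix *ᵥ (rotMatrix ^ (-s).val *ᵥ _) = _ • (rotMatrix ^ s.val *ᵥ _)
    rw [h, ← Matrix.mulVec_smul]
    congr 1
    ext n
    fin_cases n <;> simp [reflMatrix, reflSign]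
  · simp [BeamFrame.dir]

theorem reflMatrix_dir_antenna (f : BeamField) :
    reflMatrix *ᵥ A.frame.dir .antenna f = reflSign f • A.frame.dir .antenna f := by
  cases f <;> ext n <;> fin_cases n <;>
    simp [BeamFrame.dir, frame, axial, principal₁, principal₂, reflMatrix, reflSign]

theorem symmetryRep_r : A.symmetryRep (.r 1) = A.act rotMatrix (Equiv.addRight 1) := by
  change (A.act rotMatrix (Equiv.addRight 1)) ^ (1 : ZMod 3).val = _
  rw [show (1 : ZMod 3).val = 1 from rfl, pow_one]

theorem symmetryRep_sr : A.symmetryRep (.sr 0) = A.act reflMatrix (Equiv.neg _) := by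
  change A.act reflMatrix (Equiv.neg _) *
    (A.act rotMatrix (Equiv.addRight 1)) ^ (0 : ZMod 3).val = _
  rw [show (0 : ZMod 3).val = 0 from rfl, pow_zero, mul_one]

theorem leg_r (s : ZMod 3) (f : BeamField) (Ψ : A.frame.L2) :
    A.leg s f (A.symmetryRep (.r 1) Ψ) = A.leg (s - 1) f Ψ := by
  rw [symmetryRep_r]
  have hs : (Equiv.addRight (1 : ZMod 3)).symm s = s - 1 := by simp [sub_eq_add_neg]
  have h := A.sum_fieldMatrix_smul rotMatrix (.leg s) (.leg (s - 1)) (fun _ => 1)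
    rotMatrix_det.symm (fun f => by rw [rotMatrix_dir_leg, one_smul])
    (fun f => A.leg (s - 1) f Ψ) f
  rw [← hs] at h ⊢
  refine h.trans ?_
  rw [Complex.ofReal_one, one_smul]

theorem leg_sr (s : ZMod 3) (f : BeamField) (Ψ : A.frame.L2) :
    A.leg s f (A.symmetryRep (.sr 0) Ψ) = (reflSign f : ℂ) • A.leg (-s) f Ψ := by
  rw [symmetryRep_sr]
  exact A.sum_fieldMatrix_smul reflMatrix (.leg s) (.leg (-s)) reflSign
    reflMatrix_det.symm (A.reflMatrix_dir_leg s) (fun f => A.leg (-s) f Ψ) f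

theorem ant_sr (f : BeamField) (Ψ : A.frame.L2) :
    A.ant f (A.symmetryRep (.sr 0) Ψ) = (reflSign f : ℂ) • A.ant f Ψ := by
  rw [symmetryRep_sr]
  exact A.sum_fieldMatrix_smul reflMatrix .antenna .antenna reflSign
    reflMatrix_det.symm A.reflMatrix_dir_antenna (fun f => A.ant f Ψ) f

/-- The other field of the same type, if there is one. -/
def partner : BeamField → BeamField
  | .v => .w
  | .w => .v
  | .u => .u
  | .η => .η

/-- Coefficients of the rotation of the antenna: a field is multiplied by the first one, and the
multiple of its partner by the second one is added. -/
def rotDiag : BeamField → ℝ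
  | .v => Real.cos (2 * Real.pi / 3)
  | .w => Real.cos (2 * Real.pi / 3)
  | .u => 1
  | .η => 1

/-- The off-diagonal coefficients of the rotation of the antenna. -/
def rotOff : BeamField → ℝ
  | .v => - Real.sin (2 * Real.pi / 3)
  | .w => Real.sin (2 * Real.pi / 3)
  | .u => 0
  | .η => 0

/-- The antenna is vertical, so the rotation turns its horizontal vectors k and j by 2π/3, that is
(v, w) ↦ (cv − sw, sv + cw), and fixes u and η. -/
theorem ant_r (f : BeamField) (Ψ : A.frame.L2) :
    A.ant f (A.symmetryRep (.r 1) Ψ) =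
      (rotDiag f : ℂ) • A.ant f Ψ + (rotOff f : ℂ) • A.ant (partner f) Ψ := by
  rw [symmetryRep_r]
  change ∑ f', (A.fieldMatrix rotMatrix .antenna .antenna f f' : ℂ) • A.ant f' Ψ = _
  have hd : ∀ f', A.fieldMatrix rotMatrix .antenna .antenna f f' =
      A.frame.dir .antenna f ⬝ᵥ (rotMatrix *ᵥ A.frame.dir .antenna f') +
        (Matrix.single BeamField.η BeamField.η (1 : ℝ)) f f' := by
    intro f'
    have e1 : (A.dirMatrix .antenna * rotMatrix * (A.dirMatrix .antenna)ᵀ) f f' =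
        A.frame.dir .antenna f ⬝ᵥ (rotMatrix *ᵥ A.frame.dir .antenna f') := by
      rw [Matrix.mul_assoc]; rfl
    rw [← e1, fieldMatrix, rotMatrix_det, one_smul]; rfl
  rw [sum_fields, hd, hd, hd, hd]
  cases f <;>
    simp [BeamFrame.dir, frame, axial, principal₁, principal₂, rotMatrix, rotDiag, rotOff, partner,
      dotProduct, Matrix.mulVec, Fin.sum_univ_three]
  exact add_comm _ _

theorem sum_towerEdge {X : Type*} [AddCommMonoid X] (g : TowerEdge → X) :
    ∑ e, g e = g .antenna + ∑ s, g (.leg s) := by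
  have : (Finset.univ : Finset TowerEdge) =
      insert .antenna (Finset.univ.map ⟨TowerEdge.leg, fun _ _ h => TowerEdge.leg.inj h⟩) := by
    ext e
    cases e with
    | antenna => simp
    | leg s => simpa using ⟨s, rfl⟩
  rw [this, Finset.sum_insert (by simp), Finset.sum_map]
  rfl

theorem inner_eq_sum (Ψ Φ : A.frame.L2) :
    inner ℂ Ψ Φ = ∑ f, inner ℂ (A.ant f Ψ) (A.ant f Φ) +
      ∑ s, ∑ f, inner ℂ (A.leg s f Ψ) (A.leg s f Φ) := by
  rw [PiLp.inner_apply, Fintype.sum_prod_type]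
  exact sum_towerEdge _

theorem inner_r (Ψ Φ : A.frame.L2) :
    inner ℂ (A.symmetryRep (.r 1) Ψ) (A.symmetryRep (.r 1) Φ) = inner ℂ Ψ Φ := by
  have h : (Real.sin (2 * Real.pi / 3) : ℂ) * Real.sin (2 * Real.pi / 3) = 3 / 4 := by
    rw [← Complex.ofReal_mul, sin_third_sq]
    norm_num
  rw [inner_eq_sum, inner_eq_sum]
  simp only [leg_r, ant_r]
  congr 1
  · simp only [sum_fields, inner_add_left, inner_add_right, inner_smul_left, inner_smul_right,
      rotDiag, rotOff, partner, Complex.conj_ofReal, cos_third, Complex.ofReal_neg]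
    generalize (Real.sin (2 * Real.pi / 3) : ℂ) = s at h
    push_cast
    -- The mixed terms of v and w cancel, and cos² + sin² = 1 is used as s² = 3/4.
    linear_combination (inner ℂ (A.ant .v Ψ) (A.ant .v Φ) + inner ℂ (A.ant .w Ψ) (A.ant .w Φ)) * h
  · exact Equiv.sum_comp (Equiv.subRight (1 : ZMod 3)) fun s =>
      ∑ f, inner ℂ (A.leg s f Ψ) (A.leg s f Φ)

theorem inner_sr (Ψ Φ : A.frame.L2) :
    inner ℂ (A.symmetryRep (.sr 0) Ψ) (A.symmetryRep (.sr 0) Φ) = inner ℂ Ψ Φ := by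
  have h : ∀ f, (reflSign f : ℂ) * reflSign f = 1 := by
    intro f; cases f <;> simp [reflSign]
  rw [inner_eq_sum, inner_eq_sum]
  simp only [leg_sr, ant_sr, inner_smul_left, inner_smul_right, Complex.conj_ofReal, ← mul_assoc,
    h, one_mul]
  congr 1
  exact Equiv.sum_comp (Equiv.neg (ZMod 3)) fun s =>
    ∑ f, inner ℂ (A.leg s f Ψ) (A.leg s f Φ)

/-! ### The summands -/

theorem mem_eigenspace_r_iff {z : ℂ} {Ψ : A.frame.L2} :
    Ψ ∈ Module.End.eigenspace (A.symmetryRep (.r 1)) z ↔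
      (∀ f, (rotDiag f : ℂ) • A.ant f Ψ + (rotOff f : ℂ) • A.ant (partner f) Ψ = z • A.ant f Ψ) ∧
        ∀ s f, A.leg (s - 1) f Ψ = z • A.leg s f Ψ := by
  rw [Module.End.mem_eigenspace_iff]
  constructor
  · intro h
    refine ⟨fun f => ?_, fun s f => ?_⟩
    · rw [← ant_r, h, ant_smul]
    · rw [← leg_r, h, leg_smul]
  · rintro ⟨h1, h2⟩
    refine A.fields_ext (fun f => ?_) fun s f => ?_
    · rw [ant_r, h1, ant_smul]
    · rw [leg_r, h2, leg_smul]

theorem mem_eigenspace_sr_iff {z : ℂ} {Ψ : A.frame.L2} :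
    Ψ ∈ Module.End.eigenspace (A.symmetryRep (.sr 0)) z ↔
      (∀ f, (reflSign f : ℂ) • A.ant f Ψ = z • A.ant f Ψ) ∧
        ∀ s f, (reflSign f : ℂ) • A.leg (-s) f Ψ = z • A.leg s f Ψ := by
  rw [Module.End.mem_eigenspace_iff]
  constructor
  · intro h
    refine ⟨fun f => ?_, fun s f => ?_⟩
    · rw [← ant_sr, h, ant_smul]
    · rw [← leg_sr, h, leg_smul]
  · rintro ⟨h1, h2⟩
    refine A.fields_ext (fun f => ?_) fun s f => ?_
    · rw [ant_sr, h1, ant_smul]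
    · rw [leg_sr, h2, leg_smul]

end AntennaTower

end

/-! ### The four subspaces as eigenspaces of the generators. -/

noncomputable section

namespace AntennaTower

variable (A : AntennaTower)

theorem sin_third_ne_zero : (Real.sin (2 * Real.pi / 3) : ℂ) ≠ 0 := by
  intro h
  have h2 := sin_third_sq
  rw [Complex.ofReal_eq_zero.mp h] at h2
  norm_num at h2

theorem eq_zero_of_smul_eq {X : Type*} [AddCommGroup X] [Module ℂ X] {r s : ℂ} (hrs : r ≠ s) {x : X}
    (h : r • x = s • x) : x = 0 := by
  have h2 : (r - s) • x = 0 := by rw [sub_smul, h, sub_self]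
  exact (smul_eq_zero.mp h2).resolve_left (sub_ne_zero.mpr hrs)

/-- Treats κ = ±i together. A pair with w = κ v is an eigenvector of the plane rotation with
eigenvalue cos − κ sin = ξ; the fields u, η of the antenna are fixed by R, hence vanish as ξ ≠ 1. On
the legs R replaces Ψ_s by Ψ_{s−1}, so a factor ζ from each leg to the next means the eigenvalue ξ =
ζ⁻¹. -/
theorem wobble_eq_eigenspace {κ ζ ξ : ℂ} (hκ : κ ^ 2 = -1) (hξζ : ξ * ζ = 1) (hζ : ζ ^ 3 = 1)
    (hξ : ξ = Real.cos (2 * Real.pi / 3) - κ * Real.sin (2 * Real.pi / 3)) (hξ1 : 1 ≠ ξ) :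
    A.wobble κ ζ = Module.End.eigenspace (A.symmetryRep (.r 1)) ξ := by
  have hξ2 : ξ = ζ ^ 2 := by linear_combination ξ * -hζ + ζ ^ 2 * hξζ
  ext Ψ
  rw [mem_eigenspace_r_iff]
  constructor
  · rintro ⟨hu, hη, hw, hl⟩
    refine ⟨fun f => ?_, fun s f => ?_⟩
    · cases f
      · simp only [rotDiag, rotOff, partner, hw, hξ, Complex.ofReal_neg]
        module
      · simp only [rotDiag, rotOff, partner, hw, hξ]
        -- The row of w requires sin = −κ² sin, hence κ² = −1.
        linear_combination (norm := module)
          (-(Real.sin (2 * Real.pi / 3) : ℂ) * -hκ) • A.ant .v Ψ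
      · simp [partner, hu]
      · simp [partner, hη]
    · obtain ⟨h1, h2⟩ := hl f
      -- The relation between the legs 0 and 1 comes multiplied by ζ; multiplying by ξ² removes this
      -- factor and inverts the remaining one.
      have h3 : A.leg 0 f Ψ = ξ • A.leg 1 f Ψ := by
        have h4 : ξ • ξ • ζ • A.leg 1 f Ψ = ξ • ξ • ζ ^ 2 • A.leg 0 f Ψ := by rw [h2]
        rw [smul_smul, smul_smul, smul_smul, smul_smul] at h4
        rw [show ξ * ξ * ζ = ξ by rw [mul_assoc, hξζ, mul_one],
          show ξ * ξ * ζ ^ 2 = 1 by linear_combination (ξ * ζ + 1) * hξζ, one_smul] at h4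
        exact h4.symm
      obtain rfl | rfl | rfl := zmod_three_cases s
      · change A.leg 2 f Ψ = _
        rw [h1, h2, hξ2]
      · change A.leg 0 f Ψ = _
        exact h3
      · change A.leg 1 f Ψ = _
        rw [h1, smul_smul, hξζ, one_smul]
  · rintro ⟨ha, hl⟩
    refine ⟨?_, ?_, ?_, fun f => ?_⟩
    · refine eq_zero_of_smul_eq hξ1 ?_
      simpa [rotDiag, rotOff] using ha .u
    · refine eq_zero_of_smul_eq hξ1 ?_
      simpa [rotDiag, rotOff] using ha .η
    · have h := ha .v
      simp only [rotDiag, rotOff, partner, hξ, Complex.ofReal_neg] at h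
      refine smul_right_injective _ sin_third_ne_zero ?_
      simp only
      linear_combination (norm := module) -h
    · have h0 : A.leg 2 f Ψ = ξ • A.leg 0 f Ψ := hl 0 f
      have h1 : A.leg 0 f Ψ = ξ • A.leg 1 f Ψ := hl 1 f
      have h2 : A.leg 1 f Ψ = ξ • A.leg 2 f Ψ := hl 2 f
      constructor
      · rw [h2, smul_smul, mul_comm, hξζ, one_smul]
      · rw [h1, smul_smul, show ζ ^ 2 * ξ = ζ by linear_combination ζ * hξζ]

theorem wob_eq_eigenspace :
    A.wob = Module.End.eigenspace (A.symmetryRep (.r 1)) (star omega) := by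
  have h := omega_sq_add
  refine A.wobble_eq_eigenspace Complex.I_sq ((mul_comm _ _).trans omega_mul_star) ?_ ?_ ?_
  · linear_combination (omega - 1) * h
  · rw [star_omega_eq]; ring
  · intro h1
    exact omega_ne_one (by rw [← star_star omega, ← h1, star_one])

theorem wobBar_eq_eigenspace :
    A.wobBar = Module.End.eigenspace (A.symmetryRep (.r 1)) omega := by
  have h := omega_sq_add
  refine A.wobble_eq_eigenspace ?_ omega_mul_star ?_ ?_ omega_ne_one.symm
  · rw [neg_sq, Complex.I_sq]
  · rw [star_omega]; linear_combination (-2 - omega) * h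
  · rw [omega_eq]; ring

/-- F = 1 removes the fields of sign −1 on the antenna and on the first leg, and R = 1 copies the
legs. The field v of the antenna is even under F; it is removed by the row of w of the rotation,
which for w = 0 reads sin · v = 0. -/
theorem trv_eq : A.trv = dihedralSummand A.symmetryRep .trv := by
  ext Ψ
  refine Iff.trans ?_ (and_congr A.mem_eigenspace_r_iff A.mem_eigenspace_sr_iff).symm
  constructor
  · rintro ⟨hv, hw, hη, hl, v1, v2, u1, u2⟩
    have hr : ∀ s f, A.leg s f Ψ = A.leg 0 f Ψ := by
      intro s f
      obtain rfl | rfl | rfl := zmod_three_cases s <;> cases f <;> simp [*]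
    refine ⟨⟨fun f => ?_, fun s f => ?_⟩, fun f => ?_, fun s f => ?_⟩
    · cases f <;> simp [partner, rotDiag, rotOff, hv, hw, hη]
    · rw [hr, hr s, one_smul]
    · cases f <;> simp [reflSign, hv, hw, hη]
    · rw [hr, hr s]
      cases f <;> simp [reflSign, hl]
  · rintro ⟨⟨ha, hl⟩, ha', hl'⟩
    have h01 : ∀ f, A.leg 0 f Ψ = A.leg 1 f Ψ := fun f => (hl 1 f).trans (one_smul _ _)
    have h12 : ∀ f, A.leg 1 f Ψ = A.leg 2 f Ψ := fun f => (hl 2 f).trans (one_smul _ _)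
    have hneg : ((-1 : ℝ) : ℂ) ≠ 1 := by norm_num
    have hw : A.ant .w Ψ = 0 := eq_zero_of_smul_eq hneg (ha' .w)
    have hz : ∀ s f, reflSign f = -1 → A.leg s f Ψ = 0 := by
      intro s f hf
      -- The leg 0 is the one fixed by the reflection, so there the eigenvalue equation involves a
      -- single field.
      have h0 : A.leg 0 f Ψ = 0 := eq_zero_of_smul_eq hneg (by rw [← hf]; exact hl' 0 f)
      obtain rfl | rfl | rfl := zmod_three_cases s
      · exact h0
      · rw [← h01, h0]
      · rw [← h12, ← h01, h0]
    refine ⟨?_, hw, eq_zero_of_smul_eq hneg (ha' .η), fun s => ⟨hz s .w rfl, hz s .η rfl⟩, h01 _,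
      h12 _, h01 _, h12 _⟩
    have h := ha .w
    simp only [rotOff, partner, hw, smul_zero, zero_add] at h
    exact (smul_eq_zero.mp h).resolve_left sin_third_ne_zero

/-- The argument of `trv_eq` with the signs exchanged: F = −1 removes the even fields, and w on the
antenna is removed by the row of v of the rotation. -/
theorem alt_eq : A.alt = dihedralSummand A.symmetryRep .alt := by
  ext Ψ
  refine Iff.trans ?_ (and_congr A.mem_eigenspace_r_iff A.mem_eigenspace_sr_iff).symm
  constructor
  · rintro ⟨hv, hw, hu, hl, w1, w2, η1, η2⟩
    have hr : ∀ s f, A.leg s f Ψ = A.leg 0 f Ψ := by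
      intro s f
      obtain rfl | rfl | rfl := zmod_three_cases s <;> cases f <;> simp [*]
    refine ⟨⟨fun f => ?_, fun s f => ?_⟩, fun f => ?_, fun s f => ?_⟩
    · cases f <;> simp [partner, rotDiag, rotOff, hv, hw, hu]
    · rw [hr, hr s, one_smul]
    · cases f <;> simp [reflSign, hv, hw, hu]
    · rw [hr, hr s]
      cases f <;> simp [reflSign, hl]
  · rintro ⟨⟨ha, hl⟩, ha', hl'⟩
    have h01 : ∀ f, A.leg 0 f Ψ = A.leg 1 f Ψ := fun f => (hl 1 f).trans (one_smul _ _)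
    have h12 : ∀ f, A.leg 1 f Ψ = A.leg 2 f Ψ := fun f => (hl 2 f).trans (one_smul _ _)
    have hneg : ((1 : ℝ) : ℂ) ≠ -1 := by norm_num
    have hv : A.ant .v Ψ = 0 := eq_zero_of_smul_eq hneg (ha' .v)
    have hz : ∀ s f, reflSign f = 1 → A.leg s f Ψ = 0 := by
      intro s f hf
      have h0 : A.leg 0 f Ψ = 0 := eq_zero_of_smul_eq hneg (by rw [← hf]; exact hl' 0 f)
      obtain rfl | rfl | rfl := zmod_three_cases s
      · exact h0
      · rw [← h01, h0]
      · rw [← h12, ← h01, h0]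
    refine ⟨hv, ?_, eq_zero_of_smul_eq hneg (ha' .u), fun s => ⟨hz s .u rfl, hz s .v rfl⟩, h01 _,
      h12 _, h01 _, h12 _⟩
    have h := ha .v
    simp only [rotOff, partner, hv, smul_zero, zero_add] at h
    exact (smul_eq_zero.mp h).resolve_left (by simpa using sin_third_ne_zero)

theorem summand_eq : A.summand = dihedralSummand A.symmetryRep := by
  funext ρ
  cases ρ
  · exact A.trv_eq
  · exact A.alt_eq
  · exact A.wob_eq_eigenspace
  · exact A.wobBar_eq_eigenspace

/-! ### Complex conjugation -/

theorem star_smul_edge {l : ℝ} (r : ℂ) (f : EdgeL2 l) : star (r • f) = star r • star f := by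
  refine Lp.ext ?_
  filter_upwards [Lp.coeFn_star (r • f), Lp.coeFn_smul r f, Lp.coeFn_smul (star r) (star f),
    Lp.coeFn_star f] with t h1 h2 h3 h4
  rw [h1, h3, Pi.star_apply, h2, Pi.smul_apply, Pi.smul_apply, h4, Pi.star_apply, star_smul]

theorem star_zero_edge {l : ℝ} : star (0 : EdgeL2 l) = 0 := by
  simpa using star_smul_edge (0 : ℂ) (0 : EdgeL2 l)

theorem ant_conj (f : BeamField) (Ψ : A.frame.L2) : A.ant f (A.frame.conj Ψ) = star (A.ant f Ψ) :=
  rfl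

theorem leg_conj (s : ZMod 3) (f : BeamField) (Ψ : A.frame.L2) :
    A.leg s f (A.frame.conj Ψ) = star (A.leg s f Ψ) :=
  rfl

theorem conj_conj (Ψ : A.frame.L2) : A.frame.conj (A.frame.conj Ψ) = Ψ :=
  A.fields_ext (fun f => by rw [ant_conj, ant_conj, star_star])
    fun s f => by rw [leg_conj, leg_conj, star_star]

theorem conj_mem_wobble {κ ζ : ℂ} {Ψ : A.frame.L2} (h : Ψ ∈ A.wobble κ ζ) :
    A.frame.conj Ψ ∈ A.wobble (star κ) (star ζ) := by
  obtain ⟨hu, hη, hw, hl⟩ := h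
  refine ⟨?_, ?_, ?_, fun f => ⟨?_, ?_⟩⟩
  · rw [ant_conj, hu, star_zero_edge]
  · rw [ant_conj, hη, star_zero_edge]
  · rw [ant_conj, ant_conj, hw, star_smul_edge]
  · rw [leg_conj, leg_conj, (hl f).1, star_smul_edge]
  · rw [leg_conj, leg_conj, ← star_smul_edge, (hl f).2, star_smul_edge, star_pow]

theorem mem_wob_iff_conj_mem (Ψ : A.frame.L2) : Ψ ∈ A.wob ↔ A.frame.conj Ψ ∈ A.wobBar := by
  have hI : star Complex.I = -Complex.I := Complex.conj_I
  constructor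
  · intro h
    have := A.conj_mem_wobble h
    rwa [hI] at this
  · intro h
    have := A.conj_mem_wobble h
    rwa [← hI, star_star, star_star, conj_conj] at this

end AntennaTower

/-! ### Symmetries of the joint conditions -/

/-- Boundary values which arise from others by a symmetry of the frame, acting by `M` on the
displacements and forces and by `N` on the rotations and moments, satisfy the joint conditions. -/
theorem BeamFrame.JointConditions.transform {V E : Type} [Fintype E] [DecidableEq V]
    {Γ : BeamFrame V E} {β β' : Γ.BdryValues} (h : Γ.JointConditions β) (τ : Equiv.Perm E)
    {σ : V → V} (hσ : Function.Injective σ)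
    (hend : ∀ e ε, Γ.endpoint (τ e) ε = σ (Γ.endpoint e ε))
    (hcl : ∀ x, Γ.clamped (σ x) ↔ Γ.clamped x) (M N : (Fin 3 → ℂ) →ₗ[ℂ] (Fin 3 → ℂ))
    (hd : ∀ e ε, Γ.displacement β' e ε = M (Γ.displacement β (τ e) ε))
    (hr : ∀ e ε, Γ.rotation β' e ε = N (Γ.rotation β (τ e) ε))
    (hf : ∀ e ε, Γ.force β' e ε = M (Γ.force β (τ e) ε))
    (hm : ∀ e ε, Γ.moment β' e ε = N (Γ.moment β (τ e) ε)) : Γ.JointConditions β' := by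
  -- The balance at x is the image under L of the balance at σ x, reindexed by τ; injectivity of σ
  -- matches the beams incident to the two joints.
  have hsum : ∀ (L : (Fin 3 → ℂ) →ₗ[ℂ] (Fin 3 → ℂ)) (X X' : E → BeamEnd → Fin 3 → ℂ) (x : V),
      (∀ e ε, X' e ε = L (X (τ e) ε)) →
      (∑ p : E × BeamEnd, if Γ.endpoint p.1 p.2 = σ x then p.2.sign • X p.1 p.2 else 0) = 0 →
      (∑ p : E × BeamEnd, if Γ.endpoint p.1 p.2 = x then p.2.sign • X' p.1 p.2 else 0) = 0 := by
    intro L X X' x hX h0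
    rw [← Equiv.sum_comp (τ.prodCongr (Equiv.refl BeamEnd))] at h0
    have := congrArg L h0
    rw [map_sum, map_zero] at this
    refine Eq.trans (Finset.sum_congr rfl fun p _ => ?_) this
    simp only [Equiv.prodCongr_apply, Prod.map_fst, Prod.map_snd, Equiv.refl_apply, hend,
      hσ.eq_iff]
    split_ifs
    · rw [hX, map_smul]
    · rw [map_zero]
  have he : ∀ {e ε e' ε'}, Γ.endpoint e ε = Γ.endpoint e' ε' →
      Γ.endpoint (τ e) ε = Γ.endpoint (τ e') ε' := fun h => by rw [hend, hend, h]
  have hc : ∀ {e ε}, Γ.clamped (Γ.endpoint e ε) → Γ.clamped (Γ.endpoint (τ e) ε) :=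
    fun h => by rwa [hend, hcl]
  constructor
  · intro e ε e' ε' h1
    rw [hd, hd, h.displacement_eq _ _ _ _ (he h1)]
  · intro e ε e' ε' h1
    rw [hr, hr, h.rotation_eq _ _ _ _ (he h1)]
  · intro x hx
    exact hsum M _ _ x hf (h.force_balance (σ x) (mt (hcl x).mp hx))
  · intro x hx
    exact hsum N _ _ x hm (h.moment_balance (σ x) (mt (hcl x).mp hx))
  · intro e ε h1
    rw [hd, h.clamped_displacement _ _ (hc h1), map_zero]
  · intro e ε h1
    rw [hr, h.clamped_rotation _ _ (hc h1), map_zero]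

/-! ### Transport of jets and boundary values by the symmetries. -/

namespace AntennaTower

variable (A : AntennaTower)

/-- The permutation of the beams induced by a permutation of the legs. -/
def edgePerm (τ : Equiv.Perm (ZMod 3)) : Equiv.Perm TowerEdge where
  toFun
    | .antenna => .antenna
    | .leg s => .leg (τ s)
  invFun
    | .antenna => .antenna
    | .leg s => .leg (τ.symm s)
  left_inv := by rintro (_ | s) <;> simp
  right_inv := by rintro (_ | s) <;> simp

/-- The map of the joints induced by a permutation of the legs. -/
def vertexMap (τ : Equiv.Perm (ZMod 3)) : TowerVertex → TowerVertex
  | .center => .center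
  | .top => .top
  | .foot s => .foot (τ s)

theorem jointConditions_transform {β β' : A.frame.BdryValues} (h : A.frame.JointConditions β)
    (τ : Equiv.Perm (ZMod 3)) (M N : (Fin 3 → ℂ) →ₗ[ℂ] (Fin 3 → ℂ))
    (hd : ∀ e ε, A.frame.displacement β' e ε = M (A.frame.displacement β (edgePerm τ e) ε))
    (hr : ∀ e ε, A.frame.rotation β' e ε = N (A.frame.rotation β (edgePerm τ e) ε))
    (hf : ∀ e ε, A.frame.force β' e ε = M (A.frame.force β (edgePerm τ e) ε))
    (hm : ∀ e ε, A.frame.moment β' e ε = N (A.frame.moment β (edgePerm τ e) ε)) :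
    A.frame.JointConditions β' := by
  refine h.transform (edgePerm τ) (σ := vertexMap τ) ?_ ?_ ?_ M N hd hr hf hm
  · rintro (_ | _ | s) (_ | _ | s') h <;> simp_all [vertexMap]
  · rintro (_ | s) (_ | _) <;> rfl
  · rintro (_ | _ | s) <;> rfl

/-- Fields obtained by permuting the legs, multiplying the fields of the legs by `z`, and
combining the fields of the antenna with coefficients `x` and `y`. -/
def transformBdry (τ : Equiv.Perm (ZMod 3)) (x y z : BeamField → ℝ) (β : A.frame.BdryValues) :
    A.frame.BdryValues
  | .antenna, ε, f, m => x f * β .antenna ε f m + y f * β .antenna ε (partner f) m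
  | .leg s, ε, f, m => z f * β (.leg (τ s)) ε f m

/-- The derivatives of the fields described in `transformBdry`. -/
def transformJet (τ : Equiv.Perm (ZMod 3)) (x y z : BeamField → ℝ)
    (D : (e : TowerEdge) → BeamField → ℕ → EdgeL2 (A.frame.len e)) :
    (e : TowerEdge) → BeamField → ℕ → EdgeL2 (A.frame.len e)
  | .antenna, f, m => (x f : ℂ) • D .antenna f m + (y f : ℂ) • D .antenna (partner f) m
  | .leg s, f, m => (z f : ℂ) • (D (.leg (τ s)) f m : EdgeL2 A.legLen)

theorem partner_order (f : BeamField) : (partner f).order = f.order := by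
  cases f <;> rfl

/-- Weak derivatives and traces are linear, and v and w are differentiated equally often, so they
may be mixed on the antenna. -/
theorem isJet_transform {Ψ Ψ' : A.frame.L2}
    {D : (e : TowerEdge) → BeamField → ℕ → EdgeL2 (A.frame.len e)} {β : A.frame.BdryValues}
    (h : A.frame.IsJet Ψ D β) (τ : Equiv.Perm (ZMod 3)) (x y z : BeamField → ℝ)
    (ha : ∀ f, A.ant f Ψ' = (x f : ℂ) • A.ant f Ψ + (y f : ℂ) • A.ant (partner f) Ψ)
    (hl : ∀ s f, A.leg s f Ψ' = (z f : ℂ) • A.leg (τ s) f Ψ) :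
    A.frame.IsJet Ψ' (A.transformJet τ x y z D) (A.transformBdry τ x y z β) := by
  refine ⟨?_, ?_, ?_⟩
  · rintro (_ | s) f
    · refine Eq.trans ?_ (ha f).symm
      simp only [transformJet, h.zero]
      rfl
    · refine Eq.trans ?_ (hl s f).symm
      simp only [transformJet, h.zero]
      rfl
  · rintro (_ | s) f m hm
    · exact BeamFrame.IsWeakDeriv_add_smul _ _ (h.succ .antenna f m hm)
        (h.succ .antenna (partner f) m (by rwa [partner_order]))
    · have h1 := h.succ (.leg (τ s)) f m hm
      -- A single multiple is obtained from the two-term rule with second coefficient 0.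
      have := BeamFrame.IsWeakDeriv_add_smul (z f : ℂ) 0 h1 h1
      rw [zero_smul, zero_smul, add_zero, add_zero] at this
      exact this
  · rintro (_ | s) f m hm ε
    · exact BeamFrame.IsTraceAt_add_smul _ _ (h.bdry .antenna f m hm ε)
        (h.bdry .antenna (partner f) m (by rwa [partner_order]) ε)
    · have h1 := h.bdry (.leg (τ s)) f m hm ε
      have := BeamFrame.IsTraceAt_add_smul (z f : ℂ) 0 h1 h1
      rw [zero_smul, zero_mul, add_zero, add_zero] at this
      cases ε <;> exact this

theorem hamiltonianRel_transform {Ψ Φ Ψ' Φ' : A.frame.L2} (h : A.frame.HamiltonianRel Ψ Φ)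
    (τ : Equiv.Perm (ZMod 3)) (x y z : BeamField → ℝ)
    (hJ : ∀ β, A.frame.JointConditions β → A.frame.JointConditions (A.transformBdry τ x y z β))
    (ha : ∀ f, A.ant f Ψ' = (x f : ℂ) • A.ant f Ψ + (y f : ℂ) • A.ant (partner f) Ψ)
    (hl : ∀ s f, A.leg s f Ψ' = (z f : ℂ) • A.leg (τ s) f Ψ)
    (ha' : ∀ f, A.ant f Φ' = (x f : ℂ) • A.ant f Φ + (y f : ℂ) • A.ant (partner f) Φ)
    (hl' : ∀ s f, A.leg s f Φ' = (z f : ℂ) • A.leg (τ s) f Φ) :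
    A.frame.HamiltonianRel Ψ' Φ' := by
  obtain ⟨D, β, h1, h2, h3⟩ := h
  refine ⟨_, _, A.isJet_transform h1 τ x y z ha hl, hJ β h2, ?_⟩
  have h3a : ∀ f, A.ant f Φ = (A.frame.coeff .antenna f : ℂ) • D .antenna f f.order := h3 .antenna
  have h3l : ∀ s f, A.leg s f Φ = (A.frame.coeff (.leg s) f : ℂ) • D (.leg s) f f.order :=
    fun s => h3 (.leg s)
  rintro (_ | s) f
  · refine (ha' f).trans ?_
    -- For v and w this is the equality of the two bending stiffnesses of the antenna.
    have hc : A.frame.coeff .antenna (partner f) = A.frame.coeff .antenna f := by cases f <;> rfl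
    have hs : ∀ (X Y : EdgeL2 A.antennaLen) (r s t : ℂ), r • t • X + s • t • Y =
        t • (r • X + s • Y) := fun X Y r s t => by module
    rw [h3a, h3a, hc, partner_order]
    exact hs _ _ _ _ _
  · refine (hl' s f).trans ?_
    have hc : A.frame.coeff (.leg (τ s)) f = A.frame.coeff (.leg s) f := by cases f <;> rfl
    have hs : ∀ (X : EdgeL2 A.legLen) (r t : ℂ), r • t • X = t • r • X :=
      fun X r t => smul_comm r t X
    rw [h3l, hc]
    exact hs _ _ _

/-! ### Boundary vectors in the local bases. -/

/-- The vector with complex components `p`, `q`, `r` in the local basis `i`, `j`, `k`. -/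
def frameVec (e : TowerEdge) (p q r : ℂ) : Fin 3 → ℂ := fun n =>
  p * (A.frame.i e n : ℂ) + q * (A.frame.j e n : ℂ) + r * (A.frame.k e n : ℂ)

/-- With all four boundary vectors written as `frameVec`, one transformation rule for each generator
and type of beam covers them. -/
theorem displacement_eq_frameVec (β : A.frame.BdryValues) (e : TowerEdge) (ε : BeamEnd) :
    A.frame.displacement β e ε = A.frameVec e (β e ε .u 0) (β e ε .w 0) (β e ε .v 0) := rfl

theorem rotation_eq_frameVec (β : A.frame.BdryValues) (e : TowerEdge) (ε : BeamEnd) :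
    A.frame.rotation β e ε = A.frameVec e (β e ε .η 0) (-β e ε .v 1) (β e ε .w 1) := by
  ext n; simp [BeamFrame.rotation, frameVec]; ring

theorem force_eq_frameVec (β : A.frame.BdryValues) (e : TowerEdge) (ε : BeamEnd) :
    A.frame.force β e ε = A.frameVec e (A.frame.c e * β e ε .u 1) (-(A.frame.b e * β e ε .w 3))
      (-(A.frame.a e * β e ε .v 3)) := by
  ext n; simp [BeamFrame.force, frameVec]; ring

theorem moment_eq_frameVec (β : A.frame.BdryValues) (e : TowerEdge) (ε : BeamEnd) :
    A.frame.moment β e ε = A.frameVec e (A.frame.d e * β e ε .η 1) (-(A.frame.a e * β e ε .v 2))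
      (A.frame.b e * β e ε .w 2) := by
  ext n; simp [BeamFrame.moment, frameVec]; ring

/-- A real matrix acting on complex vectors. -/
def complexAction (T : Matrix (Fin 3) (Fin 3) ℝ) : (Fin 3 → ℂ) →ₗ[ℂ] (Fin 3 → ℂ) :=
  Matrix.toLin' (T.map fun x : ℝ => (x : ℂ))

theorem complexAction_frameVec (T : Matrix (Fin 3) (Fin 3) ℝ) (e : TowerEdge) (p q r : ℂ) :
    complexAction T (A.frameVec e p q r) = fun n =>
      p * ((T *ᵥ A.frame.i e) n : ℂ) + q * ((T *ᵥ A.frame.j e) n : ℂ) +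
        r * ((T *ᵥ A.frame.k e) n : ℂ) := by
  ext n
  simp only [complexAction, Matrix.toLin'_apply, Matrix.mulVec, dotProduct, Fin.sum_univ_three,
    Matrix.map_apply, frameVec]
  push_cast
  ring

theorem rot_frameVec_leg (s : ZMod 3) (p q r : ℂ) :
    complexAction rotMatrix (A.frameVec (.leg (s - 1)) p q r) = A.frameVec (.leg s) p q r := by
  have hi : rotMatrix *ᵥ A.frame.i (.leg (s - 1)) = A.frame.i (.leg s) :=
    A.rotMatrix_dir_leg s .u
  have hj : rotMatrix *ᵥ A.frame.j (.leg (s - 1)) = A.frame.j (.leg s) :=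
    A.rotMatrix_dir_leg s .w
  have hk : rotMatrix *ᵥ A.frame.k (.leg (s - 1)) = A.frame.k (.leg s) :=
    A.rotMatrix_dir_leg s .v
  rw [complexAction_frameVec, hi, hj, hk]
  rfl

theorem rot_frameVec_antenna (p q r : ℂ) :
    complexAction rotMatrix (A.frameVec .antenna p q r) =
      A.frameVec .antenna p
        (Real.cos (2 * Real.pi / 3) * q + Real.sin (2 * Real.pi / 3) * r)
        (Real.cos (2 * Real.pi / 3) * r - Real.sin (2 * Real.pi / 3) * q) := by
  have hi : A.frame.i .antenna = ![0, 0, -1] := rfl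
  have hj : A.frame.j .antenna = ![0, 1, 0] := rfl
  have hk : A.frame.k .antenna = ![1, 0, 0] := rfl
  rw [complexAction_frameVec]
  unfold frameVec
  rw [hi, hj, hk]
  ext n
  fin_cases n <;> simp [rotMatrix] <;> ring

theorem refl_frameVec (e : TowerEdge) (p q r : ℂ) :
    complexAction reflMatrix (A.frameVec (edgePerm (Equiv.neg _) e) p q r) =
      A.frameVec e p (-q) r := by
  have h : ∀ f, reflMatrix *ᵥ A.frame.dir (edgePerm (Equiv.neg _) e) f =
      reflSign f • A.frame.dir e f := by
    cases e with
    | antenna => exact A.reflMatrix_dir_antenna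
    | leg s => exact A.reflMatrix_dir_leg s
  have hi := h .u
  have hj := h .w
  have hk := h .v
  simp only [BeamFrame.dir, reflSign, one_smul] at hi hj hk
  rw [complexAction_frameVec, hi, hj, hk]
  ext n
  simp [frameVec]

theorem frameVec_neg (e : TowerEdge) (p q r : ℂ) :
    -A.frameVec e p q r = A.frameVec e (-p) (-q) (-r) := by
  ext n; simp [frameVec]; ring

/-- A proper rotation acts by the same matrix on polar and axial vectors, so R serves for all four
boundary vectors. -/
theorem jointConditions_rot (β : A.frame.BdryValues) (h : A.frame.JointConditions β) :
    A.frame.JointConditions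
      (A.transformBdry (Equiv.subRight 1) rotDiag rotOff (fun _ => 1) β) := by
  -- Equal stiffnesses let the bending forces and moments of the antenna rotate as plane vectors.
  have hab : A.frame.b .antenna = A.frame.a .antenna := rfl
  have hleg : ∀ s, edgePerm (Equiv.subRight 1) (.leg s) = .leg (s - 1) := fun _ => rfl
  have hant : edgePerm (Equiv.subRight 1) .antenna = .antenna := rfl
  refine A.jointConditions_transform h (Equiv.subRight 1) (complexAction rotMatrix)
    (complexAction rotMatrix) ?_ ?_ ?_ ?_ <;> rintro (_ | s) ε
  · rw [displacement_eq_frameVec, displacement_eq_frameVec, hant, rot_frameVec_antenna]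
    congr 1 <;> simp only [transformBdry, rotDiag, rotOff, partner] <;> push_cast <;> ring
  · rw [displacement_eq_frameVec, displacement_eq_frameVec, hleg, rot_frameVec_leg]
    simp [transformBdry]
  · rw [rotation_eq_frameVec, rotation_eq_frameVec, hant, rot_frameVec_antenna]
    congr 1 <;> simp only [transformBdry, rotDiag, rotOff, partner] <;> push_cast <;> ring
  · rw [rotation_eq_frameVec, rotation_eq_frameVec, hleg, rot_frameVec_leg]
    simp [transformBdry]
  · rw [force_eq_frameVec, force_eq_frameVec, hant, rot_frameVec_antenna, hab]
    congr 1 <;> simp only [transformBdry, rotDiag, rotOff, partner] <;> push_cast <;> ring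
  · rw [force_eq_frameVec, force_eq_frameVec, hleg, rot_frameVec_leg]
    simp [transformBdry]; rfl
  · rw [moment_eq_frameVec, moment_eq_frameVec, hant, rot_frameVec_antenna, hab]
    congr 1 <;> simp only [transformBdry, rotDiag, rotOff, partner] <;> push_cast <;> ring
  · rw [moment_eq_frameVec, moment_eq_frameVec, hleg, rot_frameVec_leg]
    simp [transformBdry]; rfl

/-- Rotations and moments are axial and det F = −1, so they transform by −F. This agrees with the
signs of the fields: η and w' change sign while v' does not. -/
theorem jointConditions_refl (β : A.frame.BdryValues) (h : A.frame.JointConditions β) :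
    A.frame.JointConditions
      (A.transformBdry (Equiv.neg _) reflSign 0 reflSign β) := by
  have hβ : ∀ e ε f m, A.transformBdry (Equiv.neg _) reflSign 0 reflSign β e ε f m =
      reflSign f * β (edgePerm (Equiv.neg _) e) ε f m := by
    rintro (_ | s) ε f m
    · simp [transformBdry, edgePerm]
    · rfl
  have ha : ∀ e, A.frame.a (edgePerm (Equiv.neg _) e) = A.frame.a e := by rintro (_ | s) <;> rfl
  have hb : ∀ e, A.frame.b (edgePerm (Equiv.neg _) e) = A.frame.b e := by rintro (_ | s) <;> rfl
  have hc : ∀ e, A.frame.c (edgePerm (Equiv.neg _) e) = A.frame.c e := by rintro (_ | s) <;> rfl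
  have hd : ∀ e, A.frame.d (edgePerm (Equiv.neg _) e) = A.frame.d e := by rintro (_ | s) <;> rfl
  refine A.jointConditions_transform h (Equiv.neg _) (complexAction reflMatrix)
    (-complexAction reflMatrix) ?_ ?_ ?_ ?_ <;> intro e ε
  · rw [displacement_eq_frameVec, displacement_eq_frameVec, refl_frameVec]
    simp [hβ, reflSign]
  · rw [rotation_eq_frameVec, rotation_eq_frameVec, LinearMap.neg_apply, refl_frameVec,
      frameVec_neg]
    simp [hβ, reflSign]
  · rw [force_eq_frameVec, force_eq_frameVec, refl_frameVec]
    simp [hβ, reflSign, ha, hb, hc]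
  · rw [moment_eq_frameVec, moment_eq_frameVec, LinearMap.neg_apply, refl_frameVec, frameVec_neg]
    simp [hβ, reflSign, ha, hb, hd]

/-! ### The generators commute with the Hamiltonian. -/

theorem mem_graph_hamiltonian_iff {Ψ Φ : A.frame.L2} :
    (Ψ, Φ) ∈ A.frame.hamiltonian.graph ↔ A.frame.HamiltonianRel Ψ Φ := by
  rw [← A.frame.hamiltonian_spec, LinearPMap.mem_graph_iff]
  constructor
  · rintro ⟨⟨y, hy⟩, e, e'⟩
    simp only at e e'
    subst e
    exact ⟨hy, e'⟩
  · rintro ⟨h, e⟩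
    exact ⟨⟨Ψ, h⟩, rfl, e⟩

theorem symmetryRep_r_mem_commutant : A.symmetryRep (.r 1) ∈ commutant A.frame.hamiltonian := by
  intro Ψ Φ h
  rw [mem_graph_hamiltonian_iff] at h ⊢
  have hl : ∀ (X : A.frame.L2) s f, A.leg s f (A.symmetryRep (.r 1) X) =
      ((1 : ℝ) : ℂ) • A.leg (Equiv.subRight 1 s) f X := fun X s f => by
    rw [leg_r, Complex.ofReal_one, one_smul, Equiv.subRight_apply]
  exact A.hamiltonianRel_transform h (Equiv.subRight 1) rotDiag rotOff (fun _ => 1)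
    A.jointConditions_rot (fun f => A.ant_r f Ψ) (hl Ψ) (fun f => A.ant_r f Φ) (hl Φ)

theorem symmetryRep_sr_mem_commutant : A.symmetryRep (.sr 0) ∈ commutant A.frame.hamiltonian := by
  intro Ψ Φ h
  rw [mem_graph_hamiltonian_iff] at h ⊢
  have ha : ∀ (X : A.frame.L2) f, A.ant f (A.symmetryRep (.sr 0) X) =
      (reflSign f : ℂ) • A.ant f X + (((0 : BeamField → ℝ) f : ℝ) : ℂ) • A.ant (partner f) X :=
    fun X f => by
      rw [ant_sr, Pi.zero_apply, Complex.ofReal_zero, zero_smul, add_zero]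
  exact A.hamiltonianRel_transform h (Equiv.neg _) reflSign 0 reflSign
    A.jointConditions_refl (ha Ψ) (fun s f => A.leg_sr s f Ψ) (ha Φ) (fun s f => A.leg_sr s f Φ)

end AntennaTower

end

theorem theorem5p1 (A : AntennaTower) :
    -- the orthogonal decomposition reduces the Hamiltonian
    IsReducedBy A.frame.hamiltonian A.summand ∧
    -- the Hamiltonian commutes with the symmetry group
    (∀ (g : DihedralGroup 3) (Ψ : A.frame.hamiltonian.domain),
      ∃ h : A.symmetryRep g (Ψ : A.frame.L2) ∈ A.frame.hamiltonian.domain,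
        A.frame.hamiltonian ⟨A.symmetryRep g (Ψ : A.frame.L2), h⟩ =
          A.symmetryRep g (A.frame.hamiltonian Ψ)) ∧
    -- the summands are the isotypic components of the irreducible representations
    A.trv = isotypicPart (Representation.trivial ℂ (DihedralGroup 3) ℂ) A.symmetryRep ∧
    A.alt = isotypicPart altRep A.symmetryRep ∧
    A.wob ⊔ A.wobBar = isotypicPart stdRep A.symmetryRep ∧
    -- the standard component is split by the characters of the subgroup of rotations
    A.wob = Module.End.eigenspace (A.symmetryRep (.r 1)) (star AntennaTower.omega) ∧
    A.wobBar = Module.End.eigenspace (A.symmetryRep (.r 1)) AntennaTower.omega ∧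
    -- the last two summands are complex conjugates of each other
    (∀ Ψ : A.frame.L2, Ψ ∈ A.wob ↔ A.frame.conj Ψ ∈ A.wobBar) ∧
    -- their eigenvalues coincide and enter the spectrum of the Hamiltonian with multiplicity two
    (∀ z : ℂ,
      Module.rank ℂ ↥(A.wob ⊓ unboundedEigenspace A.frame.hamiltonian z) =
        Module.rank ℂ ↥(A.wobBar ⊓ unboundedEigenspace A.frame.hamiltonian z) ∧
      Module.rank ℂ ↥(unboundedEigenspace A.frame.hamiltonian z) =
        Module.rank ℂ ↥(A.trv ⊓ unboundedEigenspace A.frame.hamiltonian z) +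
        Module.rank ℂ ↥(A.alt ⊓ unboundedEigenspace A.frame.hamiltonian z) +
        2 * Module.rank ℂ ↥(A.wob ⊓ unboundedEigenspace A.frame.hamiltonian z)) := by
  have hr := A.symmetryRep_r_mem_commutant
  have hs := A.symmetryRep_sr_mem_commutant
  have htrv := A.trv_eq
  have halt := A.alt_eq
  have hwob : A.wob = dihedralSummand A.symmetryRep .wob := A.wob_eq_eigenspace
  have hwobBar : A.wobBar = dihedralSummand A.symmetryRep .wobBar := A.wobBar_eq_eigenspace
  refine ⟨?_, fun g => exists_apply_eq_of_mem_commutant (rep_mem_commutant hr hs g),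
    ?_, ?_, ?_, A.wob_eq_eigenspace, A.wobBar_eq_eigenspace, A.mem_wob_iff_conj_mem, fun z => ?_⟩
  · rw [A.summand_eq]
    exact isReducedBy_dihedralSummand A.inner_r A.inner_sr hr hs
  · rw [htrv]
    exact dihedralSummand_trv_eq_isotypicPart _
  · rw [halt]
    exact dihedralSummand_alt_eq_isotypicPart _
  · rw [hwob, hwobBar]
    exact sup_eq_isotypicPart_stdRep _
  · rw [htrv, halt, hwob, hwobBar]
    exact ⟨rank_wob_inf_eq hs z, rank_unboundedEigenspace_eq A.inner_r A.inner_sr hr hs z⟩
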